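/- **Setting.** Inner products are conjugate linear in the first argument. Let $H$ be a separable complex Hilbert space and let $T$ be a closed, simple, regular, symmetric linear transformation in $H$ with deficiency indices $(1,1)$. Here $T$ need not be densely defined, and $\ker(T^*-z)$ means $\operatorname{ran}(T-\bar z)^\perp$; *regular* means that $T-x$ is bounded below for every $x\in\mathbb R$; *simple* means that $T$ does not restrict to a self-adjoint operator on any non-trivial proper closed subspace. Fix non-zero $\phi_\pm\in\ker(T^*\mp i)$ of equal norm. For $\theta\in[0,1)$ let $U_\theta$ be the unitary operator with $U_\theta(T+i)f=(T-i)f$ for $f\in\operatorname{dom}T$ and $U_\theta\phi_+=e^{2\pi i\theta}\phi_-$, and let $T_\theta:(1-U_\theta)g\mapsto i(1+U_\theta)g$ be its inverse Cayley transform. If $1$ is not an eigenvalue of $U_\theta$ (for densely defined $T$ this holds for every $\theta$), then $T_\theta$ is a self-adjoint operator extending $T$, and we say that $T_\theta$ is defined; otherwise $T_\theta$ is regarded as a linear relation. Each $x\in\mathbb R$ lies in $\sigma(T_\theta)$ for exactly one $\theta\in[0,1)$. Enumerate $\sigma(T_0)$ increasingly as $(t_n)$ by consecutive integers, the label $0$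 being given to some chosen point, and put $\tau(x)=n+\theta$ if $x\in\sigma(T_\theta)$ and $t_n\le x<t_{n+1}$ (with $n$ one less than the smallest label if $x$ lies below all $t_k$, and $n$ the largest label if $x$ lies above all $t_k$). The phase function $\tau:\mathbb R\to\mathbb R$ is smooth and strictly increasing with $\tau'>0$, and $\sigma(T_\theta)=\{x:\tau(x)-\theta\in\mathbb Z\}$. Let $t=\tau^{-1}:\operatorname{ran}\tau\to\mathbb R$ be the spectral function and let $t_n(\theta)=t(n+\theta)$ for those integers $n$ with $n+\theta\in\operatorname{ran}\tau$. For $x\in\mathbb R$ let $\phi_x$ be the unit vector in $\ker(T^*-x)$ for which $e^{-i\pi\tau(x)}(x-i)\langle\phi_x,\phi_+\rangle>0$; it exists and is unique. Put $K^T(x,y)=\langle\phi_x,\phi_y\rangle$. If $T_0$ is defined, then for $x,y\notin\sigma(T_0)$ $$K^T(x,y)=f(x)(-1)^{\lfloor\tau(x)\rfloor}\Big(\sum_k\frac{t'(k)}{(x-t_k)(y-t_k)}\Big)(-1)^{\lfloor\tau(y)\rfloor}f(y),\qquad f(x)=\Big(\sum_k\frac{t'(k)}{(x-t_k)^2}\Big)^{-1/2},$$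 where the last series converges. Let $\mu:[0,1]\to[0,1]$ be a smooth parametrization: a strictly increasing bijection, smooth on $(0,1)$, whose extension $\mu(s)=\lfloor s\rfloor+\mu(s-\lfloor s\rfloor)$ to $\mathbb R$ is smooth with $\mu'>0$ everywhere. Put $K^{(T;\mu)}(x,y)=\sqrt{(\mu\circ\tau)'(x)}\,K^T(x,y)\sqrt{(\mu\circ\tau)'(y)}$. Let $\mathcal K(T)$ and $\mathcal K(T;\mu)$ be the reproducing kernel Hilbert spaces of functions on $\mathbb R$ with kernels $K^T$ and $K^{(T;\mu)}$, and write $K^T_x$, $K^{(T;\mu)}_x$ for their point evaluation vectors. **Theorem.** All the assertions made above about $\tau$, $\sigma(T_\theta)$, $\phi_x$ and $K^T$ hold, and: 1. The identity map $f\mapsto f$ embeds $\mathcal K(T)$ isometrically into $L^2(\mathbb R,(\mu\circ\tau)'(t)\,dt)$ and embeds $\mathcal K(T;\mu)$ isometrically into $L^2(\mathbb R)$. 2. $(U^Th)(x)=\langle\phi_x,h\rangle$ defines an isometry $U^T$ of $H$ onto $\mathcal K(T)$, and $(U^{(T;\mu)}h)(x)=\sqrt{(\mu\circ\tau)'(x)}\,\langle\phi_x,h\rangle$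 defines an isometry $U^{(T;\mu)}$ of $H$ onto $\mathcal K(T;\mu)$. 3. Let $\theta\in[0,1)$ be such that $T_\theta$ is defined (any $\theta\in[0,1)$, if $T$ is densely defined). Then $\{K^T_{t_n(\theta)}\}_n$ is an orthonormal basis of $\mathcal K(T)$ consisting of eigenvectors of $U^TT_\theta(U^T)^*$ to the eigenvalues $t_n(\theta)$, and $$f(x)=\sum_n f(t_n(\theta))\,K^T(x,t_n(\theta)),\qquad f\in\mathcal K(T),\ x\in\mathbb R.$$ Likewise $\{K^{(T;\mu)}_{t_n(\theta)}\}_n$ is an orthogonal basis of $\mathcal K(T;\mu)$ with $\|K^{(T;\mu)}_{t_n(\theta)}\|^2=K^{(T;\mu)}(t_n(\theta),t_n(\theta))=(\mu\circ\tau)'(t_n(\theta))>0$ (so that $K^{(T;\mu)}_{t_n(\theta)}/\sqrt{(\mu\circ\tau)'(t_n(\theta))}$ form an orthonormal basis), it consists of eigenvectors of $U^{(T;\mu)}T_\theta(U^{(T;\mu)})^*$ to the eigenvalues $t_n(\theta)$, and $$f(x)=\sum_n f(t_n(\theta))\,\frac{K^{(T;\mu)}(x,t_n(\theta))}{K^{(T;\mu)}(t_n(\theta),t_n(\theta))},\qquad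 f\in\mathcal K(T;\mu),\ x\in\mathbb R.$$ 4. The transformations $U^TT(U^T)^*$ and $U^{(T;\mu)}T(U^{(T;\mu)})^*$ act as multiplication by the independent variable on their domains. -/

import Mathlib

open MeasureTheory Set
open scoped InnerProductSpace ContDiff

namespace LocalBandlimit

noncomputable section

section Operators

variable {H : Type*} [NormedAddCommGroup H] [InnerProductSpace ℂ H]

/-- The range of `T - z`. -/
def shiftRange (T : H →ₗ.[ℂ] H) (z : ℂ) : Submodule ℂ H :=
  LinearMap.range (T.toFun - z • T.domain.subtype)

/-- `ker (T* - z)`, that is `ran (T - z̄)ᗮ`. The right-hand side makes sense also if `T` is not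
densely defined (when `T*` is only a linear relation). -/
def adjKer (T : H →ₗ.[ℂ] H) (z : ℂ) : Submodule ℂ H :=
  (shiftRange T (starRingEnd ℂ z))ᗮ

/-- The part of `T` in the subspace `S`: its graph is `graph T ∩ (S × S)`. -/
def partIn (T : H →ₗ.[ℂ] H) (S : Submodule ℂ H) : S →ₗ.[ℂ] S :=
  (T.graph.comap (S.subtype.prodMap S.subtype)).toLinearPMap

/-- `T` is simple: it has no non-trivial proper closed subspace on which `T` restricts to a
self-adjoint operator. -/
def IsSimple (T : H →ₗ.[ℂ] H) : Prop :=
  ∀ (S : Submodule ℂ H) [CompleteSpace S], S ≠ ⊥ → S ≠ ⊤ →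
    ¬ ((∀ f : T.domain, (f : H) ∈ S → T f ∈ S) ∧ IsSelfAdjoint (partIn T S))

/-- `T` is regular: `T - x` is bounded below on `dom T` for every real `x`. -/
def IsRegular (T : H →ₗ.[ℂ] H) : Prop :=
  ∀ x : ℝ, ∃ c : ℝ, 0 < c ∧ ∀ f : T.domain, c * ‖(f : H)‖ ≤ ‖T f - (x : ℂ) • (f : H)‖

/-- The class of closed, regular, simple, symmetric linear transformations with deficiency
indices `(1,1)`. The domain need not be dense. -/
structure IsRegularSimpleSymmetric (T : H →ₗ.[ℂ] H) : Prop where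
  symmetric : ∀ f g : T.domain, ⟪T f, (g : H)⟫_ℂ = ⟪(f : H), T g⟫_ℂ
  closed : T.IsClosed
  simple : IsSimple T
  regular : IsRegular T
  index_pos : Module.finrank ℂ (adjKer T Complex.I) = 1
  index_neg : Module.finrank ℂ (adjKer T (-Complex.I)) = 1

/-- A pair of non-zero deficiency vectors of equal norm, `φ₊ ∈ ker (T* - i)` and
`φ₋ ∈ ker (T* + i)`. -/
structure IsDeficiencyPair (T : H →ₗ.[ℂ] H) (φp φm : H) : Prop where
  mem_pos : φp ∈ adjKer T Complex.I
  mem_neg : φm ∈ adjKer T (-Complex.I)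
  norm_eq : ‖φp‖ = ‖φm‖
  ne_zero : φp ≠ 0

/-- The graph of the unitary extension `U_θ = V + e^{2πiθ} ‖φ₊‖⁻² ⟪φ₊, ·⟫ φ₋` of the Cayley
transform `V : (T + i) f ↦ (T - i) f` of `T`: it is the sum of the graph of `V` on its initial
space `ran (T + i) = {φ₊}ᗮ`, and of the line spanned by `(φ₊, e^{2πiθ} φ₋)`. -/
def unitaryExtGraph (T : H →ₗ.[ℂ] H) (φp φm : H) (θ : ℝ) : Submodule ℂ (H × H) :=
  T.graph.map
      ((LinearMap.snd ℂ H H + Complex.I • LinearMap.fst ℂ H H).prod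
        (LinearMap.snd ℂ H H - Complex.I • LinearMap.fst ℂ H H))
    ⊔ Submodule.span ℂ {(φp, Complex.exp (2 * Real.pi * Complex.I * θ) • φm)}

/-- The graph of the inverse Cayley transform `T_θ : (1 - U_θ) g ↦ i (1 + U_θ) g` of `U_θ`
(a linear relation, if `1` is an eigenvalue of `U_θ`). -/
def selfAdjointExtGraph (T : H →ₗ.[ℂ] H) (φp φm : H) (θ : ℝ) : Submodule ℂ (H × H) :=
  (unitaryExtGraph T φp φm θ).map
    ((LinearMap.fst ℂ H H - LinearMap.snd ℂ H H).prod
      (Complex.I • (LinearMap.fst ℂ H H + LinearMap.snd ℂ H H)))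

/-- `T_θ` is defined as an operator: `1` is not an eigenvalue of `U_θ`. -/
def ExtDefined (T : H →ₗ.[ℂ] H) (φp φm : H) (θ : ℝ) : Prop :=
  ∀ g : H, (g, g) ∈ unitaryExtGraph T φp φm θ → g = 0

/-- The self-adjoint extension `T_θ` of `T` (meaningful if `ExtDefined T φp φm θ`). -/
def selfAdjointExt (T : H →ₗ.[ℂ] H) (φp φm : H) (θ : ℝ) : H →ₗ.[ℂ] H :=
  (selfAdjointExtGraph T φp φm θ).toLinearPMap

/-- The real spectrum of a linear relation `G`: `x` is in the resolvent set if and only if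
`(G - x)⁻¹` is the graph of a bounded operator `R`. For the graph of a (closed) operator this is
the usual spectrum. -/
def realSpectrum (G : Submodule ℂ (H × H)) : Set ℝ :=
  {x | ¬ ∃ R : H →L[ℂ] H, ∀ f h : H, (f, h + (x : ℂ) • f) ∈ G ↔ R h = f}

/-- The spectrum of `T_θ`. -/
def extSpectrum (T : H →ₗ.[ℂ] H) (φp φm : H) (θ : ℝ) : Set ℝ :=
  realSpectrum (selfAdjointExtGraph T φp φm θ)

/-- The phase function `τ`: if `θ ∈ [0,1)` is the parameter with `x ∈ σ(T_θ)`, and `σ(T_0)` is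
enumerated increasingly as `(t_n)`, with `t_0 = p`, then `τ x = n + θ` where `t_n ≤ x < t_{n+1}`.
The number `n` is written as a signed count of the points of `σ(T_0)` between `p` and `x`. -/
def phase (T : H →ₗ.[ℂ] H) (φp φm : H) (p x : ℝ) : ℝ :=
  ((extSpectrum T φp φm 0 ∩ Ioc p x).ncard : ℝ) - ((extSpectrum T φp φm 0 ∩ Ioc x p).ncard : ℝ)
    + sInf {θ : ℝ | θ ∈ Ico 0 1 ∧ x ∈ extSpectrum T φp φm θ}

/-- The spectral function `t`, the inverse of `τ` (meaningful on the range of `τ`). Thus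
`t (n + θ) = t_n(θ)` is the `n`-th point of `σ(T_θ)`. -/
def spectralFun (T : H →ₗ.[ℂ] H) (φp φm : H) (p : ℝ) : ℝ → ℝ :=
  Function.invFun (phase T φp φm p)

/-- The index set of the sampling sequence `(t_n(θ))`. -/
def SampleIdx (T : H →ₗ.[ℂ] H) (φp φm : H) (p θ : ℝ) : Type :=
  {n : ℤ // (n : ℝ) + θ ∈ range (phase T φp φm p)}

/-- The sampling points `t_n(θ) = t (n + θ)`. -/
def samplePt (T : H →ₗ.[ℂ] H) (φp φm : H) (p θ : ℝ) (n : SampleIdx T φp φm p θ) : ℝ :=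
  spectralFun T φp φm p ((n.1 : ℝ) + θ)

/-- `v` is the unit eigenvector of `T*` to the eigenvalue `x` whose phase is fixed as follows:
with `τ x = n + θ`, the vector `φ₊` has the component `e^{2πiθ} c / (x - i) • v` along `v`, where
`c = e^{-iπ(n+θ)} |c|` and `c ≠ 0`. -/
def IsModelVec (T : H →ₗ.[ℂ] H) (φp φm : H) (p x : ℝ) (v : H) : Prop :=
  v ∈ adjKer T (x : ℂ) ∧ ‖v‖ = 1 ∧
    ∃ r : ℝ, 0 < r ∧ ((x : ℂ) - Complex.I) * ⟪v, φp⟫_ℂ =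
      (r : ℂ) * Complex.exp (Real.pi * Complex.I * phase T φp φm p x)

open Classical in
/-- The vector `φ_x`, the unique `v` with `IsModelVec T φp φm p x v`. -/
def modelVec (T : H →ₗ.[ℂ] H) (φp φm : H) (p x : ℝ) : H :=
  if h : ∃ v, IsModelVec T φp φm p x v then h.choose else 0

end Operators

/-- The extension `μ_e t = ⌊t⌋ + μ (t - ⌊t⌋)` to the real line of a function on `[0,1]`. -/
def paramExt (μ : ℝ → ℝ) (t : ℝ) : ℝ := (⌊t⌋ : ℝ) + μ (Int.fract t)

/-- Smooth parametrizations of `[0,1]`. Only the values of `μ` on `[0,1]` matter. -/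
structure IsSmoothParam (μ : ℝ → ℝ) : Prop where
  strictMono : StrictMonoOn μ (Icc 0 1)
  bijOn : BijOn μ (Icc 0 1) (Icc 0 1)
  contDiffOn : ContDiffOn ℝ ∞ μ (Ioo 0 1)
  ext_contDiff : ContDiff ℝ ∞ (paramExt μ)
  deriv_pos : ∀ t : ℝ, 0 < deriv (paramExt μ) t

section Kernels

variable {H : Type*} [NormedAddCommGroup H] [InnerProductSpace ℂ H]

/-- The density `(μ ∘ τ)'`. -/
def density (T : H →ₗ.[ℂ] H) (φp φm : H) (p : ℝ) (μ : ℝ → ℝ) (x : ℝ) : ℝ :=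
  deriv (paramExt μ ∘ phase T φp φm p) x

/-- The kernel `K^T (x, y) = ⟪φ_x, φ_y⟫`. -/
def kerT (T : H →ₗ.[ℂ] H) (φp φm : H) (p x y : ℝ) : ℂ :=
  ⟪modelVec T φp φm p x, modelVec T φp φm p y⟫_ℂ

/-- The kernel `K^{(T;μ)} (x, y) = √((μ ∘ τ)' x) K^T (x, y) √((μ ∘ τ)' y)`. -/
def kerTμ (T : H →ₗ.[ℂ] H) (φp φm : H) (p : ℝ) (μ : ℝ → ℝ) (x y : ℝ) : ℂ :=
  (Real.sqrt (density T φp φm p μ x) : ℂ) * kerT T φp φm p x y *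
    (Real.sqrt (density T φp φm p μ y) : ℂ)

/-- A scalar kernel, as an operator-valued kernel on the one-dimensional space `ℂ`. -/
def toKernel (k : ℝ → ℝ → ℂ) : Matrix ℝ ℝ (ℂ →L[ℂ] ℂ) :=
  Matrix.of fun x y => k x y • ContinuousLinearMap.id ℂ ℂ

theorem posSemidef_gram (ψ : ℝ → H) : (toKernel fun x y => ⟪ψ x, ψ y⟫_ℂ).PosSemidef := by
  have h := (RKHS.posSemidef_tfae (K := toKernel fun x y => ⟪ψ x, ψ y⟫_ℂ)).out 0 2
  refine h.mpr ⟨?_, fun vv => ?_⟩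
  · ext x y
    simp [toKernel, Matrix.conjTranspose_apply, star_smul, ContinuousLinearMap.star_eq_adjoint,
      ContinuousLinearMap.adjoint_id]
  · have key : (vv.sum fun x w => vv.sum fun x' w' =>
        ⟪(toKernel fun x y => ⟪ψ x, ψ y⟫_ℂ) x' x w, w'⟫_ℂ) =
        ⟪vv.sum fun x w => w • ψ x, vv.sum fun x w => w • ψ x⟫_ℂ := by
      simp only [Finsupp.sum, _root_.sum_inner, _root_.inner_sum]
      rw [Finset.sum_comm]
      refine Finset.sum_congr rfl fun x _ => ?_
      refine Finset.sum_congr rfl fun y _ => ?_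
      simp only [toKernel, Matrix.of_apply, smul_apply, ContinuousLinearMap.id_apply,
        smul_eq_mul, RCLike.inner_apply, map_mul, inner_conj_symm, inner_smul_left,
        inner_smul_right]
      ring
    rw [key]
    exact inner_self_nonneg

variable (T : H →ₗ.[ℂ] H) (φp φm : H) (p : ℝ) (μ : ℝ → ℝ)

theorem kerTμ_eq_gram : kerTμ T φp φm p μ = fun x y =>
    ⟪(Real.sqrt (density T φp φm p μ x) : ℂ) • modelVec T φp φm p x,
      (Real.sqrt (density T φp φm p μ y) : ℂ) • modelVec T φp φm p y⟫_ℂ := by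
  funext x y
  rw [inner_smul_left, inner_smul_right, Complex.conj_ofReal, kerTμ, kerT]
  ring

instance factKerT : Fact (toKernel (kerT T φp φm p)).PosSemidef :=
  ⟨posSemidef_gram (modelVec T φp φm p)⟩

instance factKerTμ : Fact (toKernel (kerTμ T φp φm p μ)).PosSemidef :=
  ⟨by rw [kerTμ_eq_gram]; exact posSemidef_gram _⟩

/-- The local bandlimit space `𝒦(T)`: the reproducing kernel Hilbert space of functions on `ℝ`
with kernel `K^T`. -/
abbrev SpaceT : Type := RKHS.OfKernel (toKernel (kerT T φp φm p))

/-- The `L²` local bandlimit space `𝒦(T;μ)`: the reproducing kernel Hilbert space of functions on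
`ℝ` with kernel `K^{(T;μ)}`. -/
abbrev SpaceTμ : Type := RKHS.OfKernel (toKernel (kerTμ T φp φm p μ))

/-- The point evaluation vector `K_x` of a reproducing kernel Hilbert space of scalar functions on
`ℝ`, so that `⟪K_x, f⟫ = f x`. -/
def pointEval (𝒦 : Type*) [NormedAddCommGroup 𝒦] [InnerProductSpace ℂ 𝒦] [CompleteSpace 𝒦]
    [RKHS ℂ 𝒦 ℝ ℂ] (x : ℝ) : 𝒦 :=
  RKHS.kerFun 𝒦 x 1

/-- The operator `U A U*`, where `U` is unitary, with domain `U (dom A)`. -/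
def unitaryConj {𝒦 : Type*} [NormedAddCommGroup 𝒦] [InnerProductSpace ℂ 𝒦]
    (U : H ≃ₗᵢ[ℂ] 𝒦) (A : H →ₗ.[ℂ] H) : 𝒦 →ₗ.[ℂ] 𝒦 where
  domain := A.domain.comap U.symm.toLinearEquiv.toLinearMap
  toFun :=
    { toFun := fun f => U (A ⟨U.symm (f : 𝒦), f.2⟩)
      map_add' := fun f g => by
        rw [← map_add, ← A.map_add]
        congr 2
        exact Subtype.ext (map_add U.symm (f : 𝒦) g)
      map_smul' := fun c f => by
        rw [RingHom.id_apply, ← map_smul, ← A.map_smul]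
        congr 2
        exact Subtype.ext (map_smul U.symm c (f : 𝒦)) }

/-- The measure `(μ ∘ τ)'(x) dx`. -/
def weightedMeasure : Measure ℝ :=
  volume.withDensity fun x => ENNReal.ofReal (density T φp φm p μ x)

/-- The function `(∑ₙ t'(n) / (x - t_n)²)^{-1/2}` for `x ∉ σ(T_0)`. -/
def kerFactor (x : ℝ) : ℝ :=
  (∑' n : SampleIdx T φp φm p 0,
    deriv (spectralFun T φp φm p) (n.1 : ℝ) / (x - samplePt T φp φm p 0 n) ^ 2) ^ (-(1 / 2) : ℝ)

end Kernels

end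

end LocalBandlimit

open LocalBandlimit

/-! Everything is read off from the Cayley transform. Let e, d be the normalised deficiency vectors,
and let A be the Cayley transform of T on {e}ᗮ, extended by A e = 0. Then A*A = 1 - ⟨e,·⟩e
(`inner_map_map`) and ran A ⊥ d. Put z_x = (x - i)/(x + i). Regularity makes A - z_x invertible for
every real x (`isUnit_sub`), so ker(T* - x) is the line through v_x = (A - z_x)⁻¹ d. The unitary
extensions are the rank-one perturbations U_w = A + w⟨e,·⟩d, |w| = 1, and U_w v_x = z_x v_x + (1 + w
β(x)) d with β(x) = ⟨e, v_x⟩. Hence x ∈ σ(T_θ) if and only if e^{2πiθ} β(x) = -1.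

Inserting v_x and v_y into A*A = 1 - ⟨e,·⟩e gives the identity (z̄_x z_y - 1)⟨v_x, v_y⟩ = 1 - β̄(x)
β(y) (`gram_defVec`), which is used in three ways. On the diagonal it says |β| = 1. Differentiated
at the diagonal it gives β' = -2πi ρ β with ρ(x) = ‖v_x‖²/(π(1 + x²)) > 0, so the integral of ρ from
p is a smooth increasing τ with e^{2πiτ} β = -1, and counting the points of σ(T_0) identifies it
with the phase function. Off the diagonal, after normalisation, it is K^T(x,y) = sin π(τ(x) - τ(y))
/ (π(x - y) √τ'(x) √τ'(y)) (`inner_modelVec`), which vanishes when τ(x) and τ(y) differ by a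
non-zero integer.

The vectors φ_x with x ∈ σ(T_θ) are therefore orthonormal. They are total when T_θ is defined: on
their orthogonal complement U_w is a unitary with no spectrum off 1, so it is the identity there,
and 1 is not an eigenvalue (`eq_zero_of_forall_inner_eq_zero`). The sampling formulas are expansions
in these bases. At most one θ is exceptional, so Parseval's identity can be integrated over θ ∈
[0,1) against μ'(θ) dθ; unfolding s = n + θ = τ(x) turns it into the L² isometry
(`lintegral_density`). -/

namespace LocalBandlimit

noncomputable section

/-! ### The Cayley transform A and the invertibility of A - cay x. -/

section Cayley

variable {H : Type*} [NormedAddCommGroup H] [InnerProductSpace ℂ H]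

/-- `A` extends the Cayley transform of `T` by `0` on the deficiency space spanned by the unit
vector `e`; the unit vector `d` spans the other deficiency space. -/
structure IsCayley (T : H →ₗ.[ℂ] H) (e d : H) (A : H →L[ℂ] H) : Prop where
  norm_e : ‖e‖ = 1
  norm_d : ‖d‖ = 1
  map_e : A e = 0
  map_add : ∀ f : T.domain, A (T f + Complex.I • (f : H)) = T f - Complex.I • (f : H)
  inner_e : ∀ f : T.domain, ⟪e, T f + Complex.I • (f : H)⟫_ℂ = 0
  inner_d : ∀ f : T.domain, ⟪d, T f - Complex.I • (f : H)⟫_ℂ = 0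
  exists_pos : ∀ h, ⟪e, h⟫_ℂ = 0 → ∃ f : T.domain, T f + Complex.I • (f : H) = h
  exists_neg : ∀ h, ⟪d, h⟫_ℂ = 0 → ∃ f : T.domain, T f - Complex.I • (f : H) = h

theorem mem_shiftRange {T : H →ₗ.[ℂ] H} {z : ℂ} {h : H} :
    h ∈ shiftRange T z ↔ ∃ f : T.domain, T f - z • (f : H) = h := Iff.rfl

theorem mem_adjKer {T : H →ₗ.[ℂ] H} {z : ℂ} {h : H} :
    h ∈ adjKer T z ↔ ∀ f : T.domain, ⟪T f - (starRingEnd ℂ z) • (f : H), h⟫_ℂ = 0 := by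
  rw [adjKer, Submodule.mem_orthogonal]
  exact ⟨fun hh f => hh _ ⟨f, rfl⟩, fun hh u ⟨f, hf⟩ => hf ▸ hh f⟩

/-- The graph of a closed T is complete, and a lower bound for T - z on the domain is also one in
the graph norm. So (f, Tf) ↦ (T - z)f is antilipschitz on a complete space and has closed range. -/
theorem isClosed_shiftRange [CompleteSpace H] {T : H →ₗ.[ℂ] H} (hT : T.IsClosed) {z : ℂ} {c : ℝ}
    (hc : 0 < c) (hb : ∀ f : T.domain, c * ‖(f : H)‖ ≤ ‖T f - z • (f : H)‖) :
    IsClosed (shiftRange T z : Set H) := by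
  have : CompleteSpace T.graph := hT.completeSpace_coe
  let L : T.graph →L[ℂ] H :=
    (ContinuousLinearMap.snd ℂ H H - z • ContinuousLinearMap.fst ℂ H H).comp T.graph.subtypeL
  have hL : ∀ g : T.graph, L g = g.1.2 - z • g.1.1 := fun g => rfl
  have hbound : ∀ g : T.graph, ‖g‖ ≤ (c⁻¹ + (1 + ‖z‖ * c⁻¹)) * ‖L g‖ := by
    rintro ⟨⟨f, k⟩, hg⟩
    obtain ⟨y, rfl, rfl⟩ := T.mem_graph_iff.1 hg
    rw [hL]
    have h1 : ‖(y : H)‖ ≤ c⁻¹ * ‖T y - z • (y : H)‖ := by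
      rw [inv_mul_eq_div, le_div_iff₀ hc, mul_comm]; exact hb y
    have h2 : ‖T y‖ ≤ ‖T y - z • (y : H)‖ + ‖z‖ * ‖(y : H)‖ := by
      have := norm_add_le (T y - z • (y : H)) (z • (y : H))
      rwa [sub_add_cancel, norm_smul] at this
    have h3 : ‖z‖ * ‖(y : H)‖ ≤ ‖z‖ * (c⁻¹ * ‖T y - z • (y : H)‖) := by gcongr
    have h4 : 0 ≤ c⁻¹ * ‖T y - z • (y : H)‖ := by positivity
    have h5 : 0 ≤ ‖T y - z • (y : H)‖ * (1 + ‖z‖ * c⁻¹) := by positivity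
    change max ‖(y : H)‖ ‖T y‖ ≤ _
    refine max_le ?_ ?_
    · change _ ≤ _ * ‖T y - z • (y : H)‖
      nlinarith
    · change _ ≤ _ * ‖T y - z • (y : H)‖
      nlinarith
  have hanti : AntilipschitzWith (Real.toNNReal (c⁻¹ + (1 + ‖z‖ * c⁻¹))) L := by
    refine ContinuousLinearMap.antilipschitz_of_bound L fun g => ?_
    rw [Real.coe_toNNReal _ (by positivity)]
    exact hbound g
  have h := hanti.isClosed_range L.uniformContinuous
  convert h using 1
  ext h
  constructor
  · rintro ⟨f, rfl⟩
    exact ⟨⟨(f, T f), T.mem_graph f⟩, rfl⟩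
  · rintro ⟨⟨⟨f, k⟩, hg⟩, rfl⟩
    obtain ⟨y, rfl, rfl⟩ := T.mem_graph_iff.1 hg
    exact ⟨y, rfl⟩

/-- Symmetry of T cancels the cross terms. The right-hand side is the same for T - i, which makes
the Cayley transform isometric. -/
theorem inner_add_I_smul {T : H →ₗ.[ℂ] H} (hT : IsRegularSimpleSymmetric T) (f g : T.domain) :
    ⟪T f + Complex.I • (f : H), T g + Complex.I • (g : H)⟫_ℂ = ⟪T f, T g⟫_ℂ + ⟪(f : H), g⟫_ℂ := by
  simp only [inner_add_left, inner_add_right, inner_smul_left, inner_smul_right, Complex.conj_I,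
    hT.symmetric f g]
  linear_combination -⟪(f : H), g⟫_ℂ * Complex.I_mul_I

theorem inner_sub_I_smul {T : H →ₗ.[ℂ] H} (hT : IsRegularSimpleSymmetric T) (f g : T.domain) :
    ⟪T f - Complex.I • (f : H), T g - Complex.I • (g : H)⟫_ℂ = ⟪T f, T g⟫_ℂ + ⟪(f : H), g⟫_ℂ := by
  simp only [inner_sub_left, inner_sub_right, inner_smul_left, inner_smul_right, Complex.conj_I,
    hT.symmetric f g]
  linear_combination -⟪(f : H), g⟫_ℂ * Complex.I_mul_I

theorem norm_le_norm_add_I_smul {T : H →ₗ.[ℂ] H} (hT : IsRegularSimpleSymmetric T)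
    (f : T.domain) : ‖(f : H)‖ ≤ ‖T f + Complex.I • (f : H)‖ := by
  have h := inner_add_I_smul hT f f
  simp only [inner_self_eq_norm_sq_to_K] at h
  have h' : ‖T f + Complex.I • (f : H)‖ ^ 2 = ‖T f‖ ^ 2 + ‖(f : H)‖ ^ 2 := by exact_mod_cast h
  exact le_of_sq_le_sq (by nlinarith [sq_nonneg ‖T f‖]) (norm_nonneg _)

theorem norm_add_I_smul_eq {T : H →ₗ.[ℂ] H} (hT : IsRegularSimpleSymmetric T) (f : T.domain) :
    ‖T f - Complex.I • (f : H)‖ = ‖T f + Complex.I • (f : H)‖ := by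
  have h := (inner_sub_I_smul hT f f).trans (inner_add_I_smul hT f f).symm
  simp only [inner_self_eq_norm_sq_to_K] at h
  have h' : ‖T f - Complex.I • (f : H)‖ ^ 2 = ‖T f + Complex.I • (f : H)‖ ^ 2 := by exact_mod_cast h
  exact (sq_eq_sq₀ (norm_nonneg _) (norm_nonneg _)).1 h'

/-- A closed subspace with one-dimensional orthogonal complement spanned by `v` is `{v}ᗮ`. -/
theorem mem_of_inner_eq_zero [CompleteSpace H] {M : Submodule ℂ H} (hM : IsClosed (M : Set H))
    (h1 : Module.finrank ℂ Mᗮ = 1) {v : H} (hv : v ∈ Mᗮ) (hv0 : v ≠ 0) {h : H}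
    (hh : ⟪v, h⟫_ℂ = 0) : h ∈ M := by
  have : CompleteSpace M := hM.completeSpace_coe
  rw [← Submodule.orthogonal_orthogonal M, Submodule.mem_orthogonal]
  intro u hu
  obtain ⟨c, hc⟩ := (finrank_eq_one_iff_of_nonzero' (⟨v, hv⟩ : Mᗮ)
    (fun h0 => hv0 (congrArg Subtype.val h0))).1 h1 ⟨u, hu⟩
  have : c • v = u := congrArg Subtype.val hc
  rw [← this, inner_smul_left, hh, mul_zero]

theorem exists_isCayley [CompleteSpace H] {T : H →ₗ.[ℂ] H} (hT : IsRegularSimpleSymmetric T)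
    {φp φm : H} (hφ : IsDeficiencyPair T φp φm) :
    ∃ A : H →L[ℂ] H, IsCayley T ((‖φp‖⁻¹ : ℂ) • φp) ((‖φp‖⁻¹ : ℂ) • φm) A := by
  have hN : ‖φp‖ ≠ 0 := norm_ne_zero_iff.2 hφ.ne_zero
  have hNc : ((‖φp‖ : ℂ))⁻¹ ≠ 0 := inv_ne_zero (by exact_mod_cast hN)
  have hm0 : φm ≠ 0 := norm_ne_zero_iff.1 (hφ.norm_eq ▸ hN)
  have hclp : IsClosed (shiftRange T (-Complex.I) : Set H) :=
    isClosed_shiftRange hT.closed one_pos fun f => by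
      simpa using norm_le_norm_add_I_smul hT f
  have hclm : IsClosed (shiftRange T Complex.I : Set H) :=
    isClosed_shiftRange hT.closed one_pos fun f => by
      rw [norm_add_I_smul_eq hT f]
      simpa using norm_le_norm_add_I_smul hT f
  have hinj : Function.Injective (T.toFun - (-Complex.I) • T.domain.subtype) := by
    rw [injective_iff_map_eq_zero]
    intro f hf
    have h1 := norm_le_norm_add_I_smul hT f
    have h2 : T f + Complex.I • (f : H) = 0 := by
      have h3 : T f - (-Complex.I) • (f : H) = 0 := hf
      simpa using h3
    rw [h2, norm_zero] at h1
    exact Subtype.ext (norm_le_zero_iff.1 h1)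
  have hcomp : CompleteSpace (shiftRange T (-Complex.I)) := hclp.completeSpace_coe
  let E : T.domain ≃ₗ[ℂ] shiftRange T (-Complex.I) := LinearEquiv.ofInjective _ hinj
  have hE : ∀ f : T.domain, (E f : H) = T f + Complex.I • (f : H) := fun f => by
    change T f - (-Complex.I) • (f : H) = _
    simp
  let V : shiftRange T (-Complex.I) →ₗᵢ[ℂ] H :=
    { toLinearMap := (T.toFun - Complex.I • T.domain.subtype).comp E.symm.toLinearMap
      norm_map' := fun h => by
        obtain ⟨f, rfl⟩ := E.surjective h
        have h1 : ‖T f - Complex.I • (f : H)‖ = ‖(E f : H)‖ := by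
          rw [hE, norm_add_I_smul_eq hT]
        simpa using h1 }
  have hV : ∀ f, V (E f) = T f - Complex.I • (f : H) := fun f => by
    change (T.toFun - Complex.I • T.domain.subtype) (E.symm (E f)) = _
    rw [E.symm_apply_apply]; rfl
  have hpos : φp ∈ (shiftRange T (-Complex.I))ᗮ := by
    simpa [adjKer] using hφ.mem_pos
  have hneg : φm ∈ (shiftRange T (Complex.I))ᗮ := by
    simpa [adjKer] using hφ.mem_neg
  have hfp : Module.finrank ℂ (shiftRange T (-Complex.I))ᗮ = 1 := by
    rw [← hT.index_pos, adjKer, Complex.conj_I]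
  have hfm : Module.finrank ℂ (shiftRange T (Complex.I))ᗮ = 1 := by
    rw [← hT.index_neg, adjKer, map_neg, Complex.conj_I, neg_neg]
  -- A is the isometric Cayley transform V composed with the projection onto ran(T + i), hence it
  -- kills φ₊.
  refine ⟨V.toContinuousLinearMap.comp (shiftRange T (-Complex.I)).orthogonalProjectionOnto,
    ?_, ?_, ?_, ?_, ?_, ?_, ?_, ?_⟩
  · simp [norm_smul, hN]
  · simp [norm_smul, hφ.norm_eq ▸ hN, hφ.norm_eq]
  · rw [map_smul, ContinuousLinearMap.comp_apply,
      Submodule.orthogonalProjectionOnto_apply_of_mem_orthogonal hpos, map_zero, smul_zero]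
  · intro f
    rw [← hE, ContinuousLinearMap.comp_apply,
      Submodule.orthogonalProjectionOnto_mem_subspace_eq_self]
    exact hV f
  · intro f
    rw [inner_smul_left, ← hE, Submodule.inner_left_of_mem_orthogonal (E f).2 hpos, mul_zero]
  · intro f
    rw [inner_smul_left, Submodule.inner_left_of_mem_orthogonal (mem_shiftRange.2 ⟨f, rfl⟩) hneg,
      mul_zero]
  · intro h hh
    rw [inner_smul_left, mul_eq_zero] at hh
    obtain ⟨f, hf⟩ := mem_of_inner_eq_zero hclp hfp hpos hφ.ne_zero
      (hh.resolve_left (by simpa using hφ.ne_zero))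
    exact ⟨f, by rw [← hf, ← hE]; rfl⟩
  · intro h hh
    rw [inner_smul_left, mul_eq_zero] at hh
    exact mem_of_inner_eq_zero hclm hfm hneg hm0 (hh.resolve_left (by simpa using hφ.ne_zero))

/-- The Cayley transform `(x - i) / (x + i)` of a real number. -/
def cay (x : ℝ) : ℂ := ((x : ℂ) - Complex.I) / ((x : ℂ) + Complex.I)

theorem ofReal_add_I_ne_zero (x : ℝ) : (x : ℂ) + Complex.I ≠ 0 := fun h => by
  simpa using congrArg Complex.im h

theorem ofReal_sub_I_ne_zero (x : ℝ) : (x : ℂ) - Complex.I ≠ 0 := fun h => by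
  simpa using congrArg Complex.im h

theorem cay_ne_one (x : ℝ) : cay x ≠ 1 := by
  rw [cay, Ne, div_eq_one_iff_eq (ofReal_add_I_ne_zero x)]
  intro h
  have := congrArg Complex.im h
  norm_num at this

theorem conj_cay (x : ℝ) : starRingEnd ℂ (cay x) = (cay x)⁻¹ := by
  simp [cay, ← sub_eq_add_neg]

theorem cay_ne_zero (x : ℝ) : cay x ≠ 0 :=
  div_ne_zero (ofReal_sub_I_ne_zero x) (ofReal_add_I_ne_zero x)

theorem conj_cay_mul_cay (x : ℝ) : starRingEnd ℂ (cay x) * cay x = 1 := by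
  rw [conj_cay, inv_mul_cancel₀ (cay_ne_zero x)]

theorem norm_cay (x : ℝ) : ‖cay x‖ = 1 := by
  have h := conj_cay_mul_cay x
  rw [mul_comm, Complex.mul_conj, Complex.normSq_eq_norm_sq] at h
  have h2 : ‖cay x‖ ^ 2 = 1 := by exact_mod_cast h
  exact (pow_eq_one_iff_of_nonneg (norm_nonneg _) two_ne_zero).1 h2

theorem exists_cay_eq {z : ℂ} (hz : ‖z‖ = 1) (hz1 : z ≠ 1) : ∃ x : ℝ, cay x = z := by
  have h1 : 1 - z ≠ 0 := sub_ne_zero.2 (Ne.symm hz1)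
  have hzz : starRingEnd ℂ z * z = 1 := by
    rw [mul_comm, Complex.mul_conj, Complex.normSq_eq_norm_sq, hz]; norm_num
  have h1c : 1 - starRingEnd ℂ z ≠ 0 := fun h => h1 (by
    have := congrArg (starRingEnd ℂ) h; simpa using this)
  -- The inverse Cayley transform i(1 + z)/(1 - z) is real because z̄z = 1.
  obtain ⟨x, hx⟩ := Complex.conj_eq_iff_real.1
    (show starRingEnd ℂ (Complex.I * (1 + z) / (1 - z)) = Complex.I * (1 + z) / (1 - z) by
      simp only [map_div₀, map_mul, map_add, map_sub, map_one, Complex.conj_I]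
      rw [div_eq_div_iff h1c h1]
      linear_combination (2 * Complex.I) * hzz)
  refine ⟨x, ?_⟩
  have hx' : (x : ℂ) * (1 - z) = Complex.I * (1 + z) := by
    rw [← hx, div_mul_cancel₀ _ h1]
  rw [cay, div_eq_iff (ofReal_add_I_ne_zero x)]
  linear_combination hx'

theorem cay_injective : Function.Injective cay := by
  intro x y h
  rw [cay, cay, div_eq_div_iff (ofReal_add_I_ne_zero x) (ofReal_add_I_ne_zero y)] at h
  have h2 : (2 * Complex.I) * ((x : ℂ) - y) = 0 := by linear_combination h
  have h3 : (x : ℂ) - y = 0 := by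
    simpa using h2
  exact_mod_cast sub_eq_zero.1 h3

namespace IsCayley

variable {T : H →ₗ.[ℂ] H} {e d : H} {A : H →L[ℂ] H}

theorem inner_d_map (hA : IsCayley T e d A) (h : H) : ⟪d, A h⟫_ℂ = 0 := by
  have h1 : ⟪e, h - ⟪e, h⟫_ℂ • e⟫_ℂ = 0 := by
    rw [inner_sub_right, inner_smul_right, inner_self_eq_norm_sq_to_K, hA.norm_e]; simp
  obtain ⟨f, hf⟩ := hA.exists_pos _ h1
  have h2 : A h = T f - Complex.I • (f : H) := by
    rw [← hA.map_add, hf, map_sub, map_smul, hA.map_e, smul_zero, sub_zero]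
  rw [h2, hA.inner_d]

/-- This is A*A = 1 - ⟨e,·⟩e: A is isometric on {e}ᗮ = ran(T + i) and zero on e. -/
theorem inner_map_map (hT : IsRegularSimpleSymmetric T) (hA : IsCayley T e d A) (g h : H) :
    ⟪A g, A h⟫_ℂ = ⟪g, h⟫_ℂ - ⟪g, e⟫_ℂ * ⟪e, h⟫_ℂ := by
  have hee : ⟪e, e⟫_ℂ = 1 := by rw [inner_self_eq_norm_sq_to_K, hA.norm_e]; simp
  have key : ∀ h : H, ∃ f : T.domain, T f + Complex.I • (f : H) = h - ⟪e, h⟫_ℂ • e ∧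
      A h = T f - Complex.I • (f : H) := by
    intro h
    obtain ⟨f, hf⟩ := hA.exists_pos (h - ⟪e, h⟫_ℂ • e) (by
      rw [inner_sub_right, inner_smul_right, hee]; simp)
    exact ⟨f, hf, by rw [← hA.map_add, hf, map_sub, map_smul, hA.map_e, smul_zero, sub_zero]⟩
  obtain ⟨f, hf, hf'⟩ := key g
  obtain ⟨k, hk, hk'⟩ := key h
  rw [hf', hk', inner_sub_I_smul hT, ← inner_add_I_smul hT, hf, hk]
  simp only [inner_sub_left, inner_sub_right, inner_smul_left, inner_smul_right, hee,
    inner_conj_symm]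
  ring

theorem norm_map_sq (hT : IsRegularSimpleSymmetric T) (hA : IsCayley T e d A) (h : H) :
    ‖A h‖ ^ 2 = ‖h‖ ^ 2 - ‖⟪e, h⟫_ℂ‖ ^ 2 := by
  have h1 := hA.inner_map_map hT h h
  rw [← inner_conj_symm h e, RCLike.conj_mul, inner_self_eq_norm_sq_to_K,
    inner_self_eq_norm_sq_to_K] at h1
  exact_mod_cast h1

/-- Translates T - x into A - cay x; the identity behind it is i(1 + cay x) = x(1 - cay x). -/
theorem map_sub_smul (hA : IsCayley T e d A) (x : ℝ) (f : T.domain) :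
    A (T f + Complex.I • (f : H)) - cay x • (T f + Complex.I • (f : H)) =
      (1 - cay x) • (T f - (x : ℂ) • (f : H)) := by
  have hx := ofReal_add_I_ne_zero x
  have h1 : Complex.I * (1 + cay x) = x * (1 - cay x) := by
    rw [cay]; field_simp; ring
  rw [hA.map_add]
  have h2 : (Complex.I * (1 + cay x)) • (f : H) = (x * (1 - cay x)) • (f : H) := by rw [h1]
  linear_combination (norm := module) -h2

/-- As |cay x| = 1, such a v loses no norm under A, so v ⊥ e and v = (T + i)f. Then (T - x)f = 0,
and regularity gives f = 0. -/
theorem eq_zero_of_map_eq (hT : IsRegularSimpleSymmetric T) (hA : IsCayley T e d A) {x : ℝ}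
    {v : H} (hv : A v = cay x • v) : v = 0 := by
  have h1 := hA.norm_map_sq hT v
  rw [hv, norm_smul, norm_cay, one_mul] at h1
  have h2 : ⟪e, v⟫_ℂ = 0 := by
    have : ‖⟪e, v⟫_ℂ‖ ^ 2 = 0 := by linarith
    simpa using this
  obtain ⟨f, rfl⟩ := hA.exists_pos v h2
  have h3 := hA.map_sub_smul x f
  rw [hv, sub_self, eq_comm, smul_eq_zero] at h3
  have h4 := h3.resolve_left (sub_ne_zero.2 (cay_ne_one x).symm)
  obtain ⟨c, hc, hcf⟩ := hT.regular x
  have h5 := hcf f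
  rw [h4, norm_zero] at h5
  have h6 : (f : H) = 0 := norm_le_zero_iff.1 (by nlinarith [norm_nonneg (f : H)])
  have h7 : f = 0 := Subtype.ext h6
  simp [h7]

/-- The point z = 1 is not of the form cay x and needs no regularity: v = (T + i)f = (T - i)f forces
f = 0. -/
theorem eq_zero_of_map_eq_self (hT : IsRegularSimpleSymmetric T) (hA : IsCayley T e d A)
    {v : H} (hv : A v = v) : v = 0 := by
  have h1 := hA.norm_map_sq hT v
  rw [hv] at h1
  have h2 : ⟪e, v⟫_ℂ = 0 := by
    have : ‖⟪e, v⟫_ℂ‖ ^ 2 = 0 := by linarith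
    simpa using this
  obtain ⟨f, rfl⟩ := hA.exists_pos v h2
  rw [hA.map_add] at hv
  have h3 : (2 * Complex.I) • (f : H) = 0 := by
    linear_combination (norm := module) -hv
  have h7 : f = 0 := Subtype.ext (by simpa using h3)
  simp [h7]

/-- The range contains the closed subspace ran(T - x) + ℂe. A vector u orthogonal to the latter
satisfies A*u = z̄u with z = cay x, and comparing norms turns this into Az̄u = u, so z̄u is an
eigenvector of A to z, which is excluded. -/
theorem isUnit_sub [CompleteSpace H] (hT : IsRegularSimpleSymmetric T) (hA : IsCayley T e d A)
    (x : ℝ) : IsUnit (A - cay x • (1 : H →L[ℂ] H)) := by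
  have happ : ∀ h, (A - cay x • (1 : H →L[ℂ] H)) h = A h - cay x • h := fun h => rfl
  rw [ContinuousLinearMap.isUnit_iff_bijective]
  constructor
  · rw [injective_iff_map_eq_zero]
    intro v hv
    exact hA.eq_zero_of_map_eq hT (sub_eq_zero.1 hv)
  · obtain ⟨c, hc, hcf⟩ := hT.regular x
    have hcl : IsClosed ((shiftRange T x ⊔ Submodule.span ℂ {e} : Submodule ℂ H) : Set H) :=
      Submodule.isClosed_sup_finiteDimensional _ _ (isClosed_shiftRange hT.closed hc hcf)
    have hle : shiftRange T x ⊔ Submodule.span ℂ {e} ≤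
        LinearMap.range (A - cay x • (1 : H →L[ℂ] H)).toLinearMap := by
      refine sup_le ?_ ?_
      · rintro _ ⟨f, rfl⟩
        refine ⟨(1 - cay x)⁻¹ • (T f + Complex.I • (f : H)), ?_⟩
        rw [map_smul, ContinuousLinearMap.coe_coe, happ, hA.map_sub_smul,
          inv_smul_smul₀ (sub_ne_zero.2 (cay_ne_one x).symm)]
        rfl
      · rw [Submodule.span_singleton_le_iff_mem]
        refine ⟨-(cay x)⁻¹ • e, ?_⟩
        rw [map_smul, ContinuousLinearMap.coe_coe, happ, hA.map_e, zero_sub, neg_smul, smul_neg,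
          neg_neg, inv_smul_smul₀ (cay_ne_zero x)]
    have : CompleteSpace (shiftRange T x ⊔ Submodule.span ℂ {e} : Submodule ℂ H) :=
      hcl.completeSpace_coe
    have htop : shiftRange T x ⊔ Submodule.span ℂ {e} = ⊤ := by
      rw [← Submodule.orthogonal_eq_bot_iff, Submodule.eq_bot_iff]
      intro u hu
      have hue : ⟪e, u⟫_ℂ = 0 := Submodule.inner_right_of_mem_orthogonal
        (Submodule.mem_sup_right (Submodule.mem_span_singleton_self e)) hu
      have huT : ∀ f : T.domain, ⟪T f - (x : ℂ) • (f : H), u⟫_ℂ = 0 := fun f =>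
        Submodule.inner_right_of_mem_orthogonal
          (Submodule.mem_sup_left (mem_shiftRange.2 ⟨f, rfl⟩)) hu
      have hall : ∀ g : H, ⟪A g - cay x • g, u⟫_ℂ = 0 := by
        intro g
        obtain ⟨f, hf⟩ := hA.exists_pos (g - ⟪e, g⟫_ℂ • e) (by
          rw [inner_sub_right, inner_smul_right, inner_self_eq_norm_sq_to_K, hA.norm_e]; simp)
        have h1 := hA.map_sub_smul x f
        rw [hf, map_sub, map_smul, hA.map_e] at h1
        have h2 : A g - cay x • g =
            (1 - cay x) • (T f - (x : ℂ) • (f : H)) - (cay x * ⟪e, g⟫_ℂ) • e := by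
          rw [← h1]; module
        rw [h2, inner_sub_left, inner_smul_left, inner_smul_left, huT, hue]; simp
      obtain ⟨k, hk⟩ := hA.exists_neg (u - ⟪d, u⟫_ℂ • d) (by
          rw [inner_sub_right, inner_smul_right, inner_self_eq_norm_sq_to_K, hA.norm_d]; simp)
      -- h is A*u: the preimage in ran(T + i) of the component of u orthogonal to d.
      set h := T k + Complex.I • (k : H) with hh
      have hAh : A h = u - ⟪d, u⟫_ℂ • d := by rw [hh, hA.map_add, hk]
      have heh : ⟪e, h⟫_ℂ = 0 := hA.inner_e k
      have h3 : ∀ g : H, ⟪g, h⟫_ℂ = ⟪cay x • g, u⟫_ℂ := by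
        intro g
        have h4 := hA.inner_map_map hT g h
        rw [heh, mul_zero, sub_zero, hAh, inner_sub_right, inner_smul_right,
          ← inner_conj_symm (A g) d, hA.inner_d_map, map_zero, mul_zero, sub_zero] at h4
        have h5 := hall g
        rw [inner_sub_left, sub_eq_zero] at h5
        rw [← h4, h5]
      have h6 : h = starRingEnd ℂ (cay x) • u := by
        refine ext_inner_left ℂ fun g => ?_
        rw [h3, inner_smul_left, inner_smul_right]
      have h8 : ‖h‖ = ‖u‖ := by rw [h6, norm_smul, RCLike.norm_conj, norm_cay, one_mul]
      -- A h has the norm of h, hence of u, but it is u with its d-component removed; that component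
      -- must vanish.
      have h9 : ⟪u, d⟫_ℂ * ⟪d, u⟫_ℂ = 0 := by
        have h10 : ⟪A h, A h⟫_ℂ = ⟪h, h⟫_ℂ := by rw [hA.inner_map_map hT, heh, mul_zero, sub_zero]
        have h11 : ⟪h, h⟫_ℂ = ⟪u, u⟫_ℂ := by
          rw [inner_self_eq_norm_sq_to_K, inner_self_eq_norm_sq_to_K, h8]
        rw [h11, hAh] at h10
        simp only [inner_sub_left, inner_sub_right, inner_smul_left, inner_smul_right,
          inner_self_eq_norm_sq_to_K d, hA.norm_d, inner_conj_symm] at h10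
        simp only [RCLike.ofReal_one, one_pow] at h10
        linear_combination -h10
      have h12 : ⟪d, u⟫_ℂ = 0 := by
        rcases mul_eq_zero.1 h9 with h | h
        · exact inner_eq_zero_symm.1 h
        · exact h
      rw [h12, zero_smul, sub_zero] at hAh
      have h13 : A h = cay x • h := by
        rw [hAh, h6, smul_smul, mul_comm, conj_cay_mul_cay, one_smul]
      have h14 := hA.eq_zero_of_map_eq hT h13
      rw [← hAh, h14, map_zero]
    intro u
    exact hle (htop ▸ Submodule.mem_top)

end IsCayley

end Cayley

/-! ### The vectors v_x, the unitary extensions and the totality of their eigenvectors. -/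

section DefectVectors

variable {H : Type*} [NormedAddCommGroup H] [InnerProductSpace ℂ H]

/-- A unitary operator without spectrum outside `{1}` is the identity. -/
theorem eq_one_of_forall_eigen {E : Type*} [NormedAddCommGroup E] [InnerProductSpace ℂ E]
    [CompleteSpace E] (W : E →L[ℂ] E) (hW : ∀ a b, ⟪W a, W b⟫_ℂ = ⟪a, b⟫_ℂ)
    (hsurj : Function.Surjective W)
    (hz : ∀ z : ℂ, ‖z‖ = 1 → z ≠ 1 →
      (∀ t, W t = z • t → t = 0) ∧ ∀ k, ∃ h, W h = z • h + k) : W = 1 := by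
  have hWstar : star W * W = 1 := by
    rw [ContinuousLinearMap.star_eq_adjoint]
    exact (ContinuousLinearMap.inner_map_map_iff_adjoint_comp_self W).1 hW
  have hWstar' : W * star W = 1 := by
    ext1 k
    obtain ⟨h, rfl⟩ := hsurj k
    change W ((star W * W) h) = W h
    rw [hWstar]; rfl
  have hspec : spectrum ℂ W ⊆ {1} := by
    intro z hzs
    by_contra hz1
    have hz2 := spectrum.subset_circle_of_unitary (⟨hWstar, hWstar'⟩ : W ∈ unitary (E →L[ℂ] E)) hzs
    obtain ⟨hi, hs⟩ := hz z (by simpa using hz2) hz1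
    apply hzs
    rw [spectrum.mem_resolventSet_iff, ← IsUnit.sub_iff, ContinuousLinearMap.isUnit_iff_bijective]
    constructor
    · rw [injective_iff_map_eq_zero]
      exact fun t ht => hi t (sub_eq_zero.1 ht)
    · intro k
      obtain ⟨h, hh⟩ := hs k
      exact ⟨h, sub_eq_iff_eq_add'.2 hh⟩
  have : IsStarNormal W := ⟨by rw [Commute, SemiconjBy, hWstar, hWstar']⟩
  exact CFC.eq_one_of_spectrum_subset_one (R := ℂ) W hspec

/-- The vector `(A - cay x)⁻¹ d`, which spans `ker (T* - x)`. -/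
def defVec (A : H →L[ℂ] H) (d : H) (x : ℝ) : H :=
  Ring.inverse (A - cay x • (1 : H →L[ℂ] H)) d

/-- The unitary extension `A + w ⟪e, ·⟫ d` of the Cayley transform. -/
def extMap (A : H →L[ℂ] H) (e d : H) (w : ℂ) : H →L[ℂ] H :=
  A + w • (innerSL ℂ e).smulRight d

theorem extMap_apply (A : H →L[ℂ] H) (e d : H) (w : ℂ) (h : H) :
    extMap A e d w h = A h + (w * ⟪e, h⟫_ℂ) • d := by
  simp [extMap, smul_smul]

namespace IsCayley

variable {T : H →ₗ.[ℂ] H} {e d : H} {A : H →L[ℂ] H}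

theorem inner_d_self (hA : IsCayley T e d A) : ⟪d, d⟫_ℂ = 1 := by
  rw [inner_self_eq_norm_sq_to_K, hA.norm_d]; simp

theorem inner_e_self (hA : IsCayley T e d A) : ⟪e, e⟫_ℂ = 1 := by
  rw [inner_self_eq_norm_sq_to_K, hA.norm_e]; simp

/-- The summand w⟨e,·⟩d restores exactly the norm that A loses, in the direction d orthogonal to ran
A. -/
theorem inner_extMap (hT : IsRegularSimpleSymmetric T) (hA : IsCayley T e d A) {w : ℂ}
    (hw : starRingEnd ℂ w * w = 1) (g h : H) :
    ⟪extMap A e d w g, extMap A e d w h⟫_ℂ = ⟪g, h⟫_ℂ := by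
  rw [extMap_apply, extMap_apply]
  simp only [inner_add_left, inner_add_right, inner_smul_left, inner_smul_right,
    hA.inner_d_self, hA.inner_map_map hT, hA.inner_d_map, inner_eq_zero_symm.1 (hA.inner_d_map g),
    map_mul, inner_conj_symm]
  linear_combination ⟪g, e⟫_ℂ * ⟪e, h⟫_ℂ * hw

/-- At most one unitary extension has the eigenvalue 1. A combination of two fixed vectors
cancelling the d-terms is fixed by A, hence zero; its component along e compares the two parameters.
-/
theorem param_eq_of_extMap_eq_self (hT : IsRegularSimpleSymmetric T) (hA : IsCayley T e d A)
    {w₁ w₂ : ℂ} {g₁ g₂ : H} (h₁ : extMap A e d w₁ g₁ = g₁) (h₂ : extMap A e d w₂ g₂ = g₂)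
    (hg₁ : g₁ ≠ 0) (hg₂ : g₂ ≠ 0) : w₁ = w₂ := by
  rw [extMap_apply] at h₁ h₂
  have hne : ∀ {w : ℂ} {g : H}, A g + (w * ⟪e, g⟫_ℂ) • d = g → g ≠ 0 → ⟪e, g⟫_ℂ ≠ 0 := by
    intro w g h hg h0
    rw [h0, mul_zero, zero_smul, add_zero] at h
    exact hg (hA.eq_zero_of_map_eq_self hT h)
  have key : (w₂ * ⟪e, g₂⟫_ℂ) • g₁ - (w₁ * ⟪e, g₁⟫_ℂ) • g₂ = 0 := by
    apply hA.eq_zero_of_map_eq_self hT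
    rw [map_sub, map_smul, map_smul, eq_sub_of_add_eq h₁, eq_sub_of_add_eq h₂]
    module
  have h3 := congrArg (fun k => ⟪e, k⟫_ℂ) key
  simp only [inner_sub_right, inner_smul_right, inner_zero_right] at h3
  have h4 : (w₂ - w₁) * (⟪e, g₁⟫_ℂ * ⟪e, g₂⟫_ℂ) = 0 := by linear_combination h3
  have h5 := (mul_eq_zero.1 h4).resolve_right (mul_ne_zero (hne h₁ hg₁) (hne h₂ hg₂))
  exact (sub_eq_zero.1 h5).symm

theorem extMap_surjective (hA : IsCayley T e d A) {w : ℂ}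
    (hw : starRingEnd ℂ w * w = 1) : Function.Surjective (extMap A e d w) := by
  intro k
  obtain ⟨f, hf⟩ := hA.exists_neg (k - ⟪d, k⟫_ℂ • d) (by
    rw [inner_sub_right, inner_smul_right, hA.inner_d_self, mul_one, sub_self])
  refine ⟨T f + Complex.I • (f : H) + (starRingEnd ℂ w * ⟪d, k⟫_ℂ) • e, ?_⟩
  rw [extMap_apply, _root_.map_add, map_smul A, hA.map_e, hA.map_add, hf, inner_add_right, hA.inner_e,
    inner_smul_right, hA.inner_e_self]
  have : w * (0 + starRingEnd ℂ w * ⟪d, k⟫_ℂ * 1) = ⟪d, k⟫_ℂ := by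
    linear_combination ⟪d, k⟫_ℂ * hw
  rw [this]
  module

variable [CompleteSpace H]

theorem exists_map_sub (hT : IsRegularSimpleSymmetric T) (hA : IsCayley T e d A) (x : ℝ) (k : H) :
    ∃ h, A h = cay x • h + k := by
  obtain ⟨h, hh⟩ := (ContinuousLinearMap.isUnit_iff_bijective.1 (hA.isUnit_sub hT x)).2 k
  refine ⟨h, ?_⟩
  rw [← hh]
  change _ = _ + (A h - cay x • h)
  abel

theorem map_defVec (hT : IsRegularSimpleSymmetric T) (hA : IsCayley T e d A) (x : ℝ) :
    A (defVec A d x) = cay x • defVec A d x + d := by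
  have h1 := Ring.mul_inverse_cancel _ (hA.isUnit_sub hT x)
  have h2 : (A - cay x • (1 : H →L[ℂ] H)) (defVec A d x) = d := by
    change ((A - cay x • (1 : H →L[ℂ] H)) * Ring.inverse (A - cay x • (1 : H →L[ℂ] H))) d = d
    rw [h1]; rfl
  have h3 : A (defVec A d x) - cay x • defVec A d x = d := h2
  rw [← sub_eq_iff_eq_add', h3]

theorem eq_smul_defVec (hT : IsRegularSimpleSymmetric T) (hA : IsCayley T e d A) {x : ℝ} {h : H}
    {c : ℂ} (hh : A h = cay x • h + c • d) : h = c • defVec A d x := by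
  rw [← sub_eq_zero]
  apply hA.eq_zero_of_map_eq hT (x := x)
  rw [map_sub, map_smul, hA.map_defVec hT, hh]
  module

theorem defVec_ne_zero (hT : IsRegularSimpleSymmetric T) (hA : IsCayley T e d A) (x : ℝ) :
    defVec A d x ≠ 0 := fun h => by
  have h1 := hA.map_defVec hT x
  rw [h, map_zero, smul_zero, zero_add] at h1
  have := hA.norm_d
  rw [← h1, norm_zero] at this
  exact zero_ne_one this

/-- Apply A*A = 1 - ⟨e,·⟩e to v_x and v_y, and use A v_x = cay x v_x + d. The terms with d are
evaluated by ran A ⊥ d, that is cay x ⟨d, v_x⟩ = -1. -/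
theorem gram_defVec (hT : IsRegularSimpleSymmetric T) (hA : IsCayley T e d A) (x y : ℝ) :
    (starRingEnd ℂ (cay x) * cay y - 1) * ⟪defVec A d x, defVec A d y⟫_ℂ =
      1 - starRingEnd ℂ ⟪e, defVec A d x⟫_ℂ * ⟪e, defVec A d y⟫_ℂ := by
  have h1 := hA.inner_map_map hT (defVec A d x) (defVec A d y)
  have h2 : ∀ z, cay z * ⟪d, defVec A d z⟫_ℂ + 1 = 0 := fun z => by
    have := hA.inner_d_map (defVec A d z)
    rwa [hA.map_defVec hT, inner_add_right, inner_smul_right, hA.inner_d_self] at this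
  have h3 : starRingEnd ℂ (cay x) * ⟪defVec A d x, d⟫_ℂ + 1 = 0 := by
    have := congrArg (starRingEnd ℂ) (h2 x)
    simpa using this
  rw [hA.map_defVec hT, hA.map_defVec hT] at h1
  simp only [inner_add_left, inner_add_right, inner_smul_left, inner_smul_right,
    hA.inner_d_self] at h1
  rw [inner_conj_symm]
  linear_combination h1 - h2 y - h3

theorem conj_inner_mul_inner (hT : IsRegularSimpleSymmetric T) (hA : IsCayley T e d A) (x : ℝ) :
    starRingEnd ℂ ⟪e, defVec A d x⟫_ℂ * ⟪e, defVec A d x⟫_ℂ = 1 := by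
  have h := hA.gram_defVec hT x x
  rw [conj_cay_mul_cay, sub_self, zero_mul] at h
  linear_combination h

/-- A vector h lies in ker(T* - x) exactly when (A - cay x)h is a multiple of d; invertibility of A
- cay x makes this the line through v_x. -/
theorem mem_adjKer_iff (hT : IsRegularSimpleSymmetric T) (hA : IsCayley T e d A) {x : ℝ} {h : H} :
    h ∈ adjKer T (x : ℂ) ↔ ∃ c : ℂ, h = c • defVec A d x := by
  rw [mem_adjKer]
  have hz := conj_cay_mul_cay x
  have hm : ∀ f : T.domain, starRingEnd ℂ (1 - cay x) *
      ⟪T f - (x : ℂ) • (f : H), h⟫_ℂ = ⟪A (T f + Complex.I • (f : H)), h⟫_ℂ -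
        starRingEnd ℂ (cay x) * ⟪T f + Complex.I • (f : H), h⟫_ℂ := fun f => by
    rw [← inner_smul_left, ← hA.map_sub_smul, inner_sub_left, inner_smul_left]
  simp only [Complex.conj_ofReal]
  constructor
  · intro hh
    refine ⟨⟪d, A h - cay x • h⟫_ℂ, hA.eq_smul_defVec hT ?_⟩
    -- The part of (A - cay x)h orthogonal to d. It has the form (T - i)f, and orthogonality of h to
    -- (T - x)f makes k orthogonal to itself.
    set k := A h - cay x • h - ⟪d, A h - cay x • h⟫_ℂ • d with hk
    have hdk : ⟪d, k⟫_ℂ = 0 := by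
      rw [hk, inner_sub_right, inner_smul_right, hA.inner_d_self, mul_one, sub_self]
    have hk0 : k = 0 := by
      obtain ⟨f, hf⟩ := hA.exists_neg k hdk
      rw [← inner_self_eq_zero (𝕜 := ℂ)]
      have h1 := hm f
      rw [hh f, mul_zero, hA.map_add, hf] at h1
      have h2 : ⟪k, A h⟫_ℂ = ⟪T f + Complex.I • (f : H), h⟫_ℂ := by
        have h3 := hA.inner_map_map hT (T f + Complex.I • (f : H)) h
        rwa [hA.map_add, hf, inner_eq_zero_symm.1 (hA.inner_e f), zero_mul, sub_zero] at h3
      have h4 : ⟪k, k⟫_ℂ = ⟪k, A h - cay x • h - ⟪d, A h - cay x • h⟫_ℂ • d⟫_ℂ := by rw [← hk]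
      rw [h4, inner_sub_right, inner_sub_right, inner_smul_right, inner_smul_right,
        inner_eq_zero_symm.1 hdk, h2]
      linear_combination cay x * h1 - ⟪T f + Complex.I • (f : H), h⟫_ℂ * hz
    rw [hk, sub_eq_zero, sub_eq_iff_eq_add'] at hk0
    exact hk0
  · rintro ⟨c, rfl⟩ f
    have h1 := hm f
    have h2 := hA.inner_map_map hT (T f + Complex.I • (f : H)) (defVec A d x)
    rw [hA.map_defVec hT, inner_add_right, inner_smul_right,
      inner_eq_zero_symm.1 (hA.inner_d_map _), inner_eq_zero_symm.1 (hA.inner_e f)] at h2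
    have h3 : starRingEnd ℂ (1 - cay x) ≠ 0 := by
      rw [Ne, map_eq_zero, sub_eq_zero]
      exact (cay_ne_one x).symm
    apply (mul_eq_zero.1 (h1.trans _)).resolve_left h3
    rw [inner_smul_right, inner_smul_right]
    linear_combination c * starRingEnd ℂ (cay x) * h2 -
      c * ⟪A (T f + Complex.I • (f : H)), defVec A d x⟫_ℂ * hz

theorem extMap_defVec (hT : IsRegularSimpleSymmetric T) (hA : IsCayley T e d A) (w : ℂ) (x : ℝ) :
    extMap A e d w (defVec A d x) =
      cay x • defVec A d x + (1 + w * ⟪e, defVec A d x⟫_ℂ) • d := by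
  rw [extMap_apply, hA.map_defVec hT]
  module

theorem eq_smul_of_extMap_eq (hT : IsRegularSimpleSymmetric T) (hA : IsCayley T e d A) {w : ℂ}
    {x : ℝ} {h : H} (hh : extMap A e d w h = cay x • h) :
    h = (-(w * ⟪e, h⟫_ℂ)) • defVec A d x := by
  apply hA.eq_smul_defVec hT
  rw [extMap_apply] at hh
  rw [← hh]
  module

theorem eq_zero_of_extMap_eq (hT : IsRegularSimpleSymmetric T) (hA : IsCayley T e d A) {w : ℂ}
    {x : ℝ} (hx : 1 + w * ⟪e, defVec A d x⟫_ℂ ≠ 0) {h : H}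
    (hh : extMap A e d w h = cay x • h) : h = 0 := by
  have h1 := hA.eq_smul_of_extMap_eq hT hh
  have h2 := congrArg (fun k => ⟪e, k⟫_ℂ) h1
  simp only [inner_smul_right] at h2
  have h3 : (1 + w * ⟪e, defVec A d x⟫_ℂ) * ⟪e, h⟫_ℂ = 0 := by linear_combination h2
  rw [h1, (mul_eq_zero.1 h3).resolve_left hx, mul_zero, neg_zero, zero_smul]

/-- Solve with A in place of U, then correct by a multiple of v_x, which changes the equation only
in the direction d. -/
theorem exists_extMap_sub (hT : IsRegularSimpleSymmetric T) (hA : IsCayley T e d A) {w : ℂ}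
    {x : ℝ} (hx : 1 + w * ⟪e, defVec A d x⟫_ℂ ≠ 0) (k : H) :
    ∃ h, extMap A e d w h = cay x • h + k := by
  obtain ⟨h, hh⟩ := hA.exists_map_sub hT x k
  refine ⟨h - (w * ⟪e, h⟫_ℂ / (1 + w * ⟪e, defVec A d x⟫_ℂ)) • defVec A d x, ?_⟩
  rw [map_sub, map_smul, hA.extMap_defVec hT, extMap_apply, hh, smul_add, smul_smul _ _ d,
    div_mul_cancel₀ _ hx]
  module

theorem isUnit_extMap_sub (hT : IsRegularSimpleSymmetric T) (hA : IsCayley T e d A) {w : ℂ}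
    {x : ℝ} (hx : 1 + w * ⟪e, defVec A d x⟫_ℂ ≠ 0) :
    IsUnit (extMap A e d w - cay x • (1 : H →L[ℂ] H)) := by
  rw [ContinuousLinearMap.isUnit_iff_bijective]
  constructor
  · rw [injective_iff_map_eq_zero]
    intro v hv
    exact hA.eq_zero_of_extMap_eq hT hx (sub_eq_zero.1 hv)
  · intro k
    obtain ⟨h, hh⟩ := hA.exists_extMap_sub hT hx k
    exact ⟨h, sub_eq_iff_eq_add'.2 hh⟩

theorem inner_defVec_map (hT : IsRegularSimpleSymmetric T) (hA : IsCayley T e d A)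
    (x : ℝ) (h : H) : ⟪defVec A d x, A h⟫_ℂ =
      cay x * ⟪defVec A d x, h⟫_ℂ - cay x * ⟪defVec A d x, e⟫_ℂ * ⟪e, h⟫_ℂ := by
  have h1 := hA.inner_map_map hT (defVec A d x) h
  rw [hA.map_defVec hT, inner_add_left, inner_smul_left, hA.inner_d_map] at h1
  linear_combination cay x * h1 - ⟪defVec A d x, A h⟫_ℂ * conj_cay_mul_cay x

/-- If `k` is orthogonal to the eigenvector, `(U - cay x) h = k` is solvable with `h` orthogonal
to the eigenvector. -/
theorem exists_extMap_sub_of_inner_eq_zero (hT : IsRegularSimpleSymmetric T)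
    (hA : IsCayley T e d A) {w : ℂ} {x : ℝ} (hx : 1 + w * ⟪e, defVec A d x⟫_ℂ = 0) {k : H}
    (hk : ⟪defVec A d x, k⟫_ℂ = 0) :
    ∃ h, extMap A e d w h = cay x • h + k ∧ ⟪defVec A d x, h⟫_ℂ = 0 := by
  obtain ⟨h, hh⟩ := hA.exists_map_sub hT x k
  have h1 := hA.inner_defVec_map hT x h
  rw [hh, inner_add_right, inner_smul_right, hk] at h1
  -- Pairing A h = cay x h + k with v_x leaves only the e-term; since ⟨e, h⟩ = 0, U and A agree on
  -- h.
  have h2 : ⟪e, h⟫_ℂ = 0 := by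
    have h3 : ⟪defVec A d x, e⟫_ℂ ≠ 0 := fun h0 => by
      rw [inner_eq_zero_symm.1 h0, mul_zero, add_zero] at hx
      exact one_ne_zero hx
    have h4 : cay x * ⟪defVec A d x, e⟫_ℂ * ⟪e, h⟫_ℂ = 0 := by linear_combination h1
    exact (mul_eq_zero.1 h4).resolve_left (mul_ne_zero (cay_ne_zero x) h3)
  have hv : ⟪defVec A d x, defVec A d x⟫_ℂ ≠ 0 := by
    rw [Ne, inner_self_eq_zero]; exact hA.defVec_ne_zero hT x
  refine ⟨h - (⟪defVec A d x, h⟫_ℂ / ⟪defVec A d x, defVec A d x⟫_ℂ) • defVec A d x, ?_, ?_⟩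
  · rw [map_sub, map_smul, hA.extMap_defVec hT, extMap_apply, hh, h2, hx]
    module
  · rw [inner_sub_right, inner_smul_right, div_mul_cancel₀ _ hv, sub_self]

/-- The eigenvectors `v_x` of the unitary `U = A + w ⟪e, ·⟫ d` form a total set, if `1` is not an
eigenvalue of `U`. -/
theorem eq_zero_of_forall_inner_eq_zero (hT : IsRegularSimpleSymmetric T)
    (hA : IsCayley T e d A) {w : ℂ} (hw : starRingEnd ℂ w * w = 1)
    (h1 : ∀ g, extMap A e d w g = g → g = 0) {s : H}
    (hs : ∀ x : ℝ, 1 + w * ⟪e, defVec A d x⟫_ℂ = 0 → ⟪defVec A d x, s⟫_ℂ = 0) : s = 0 := by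
  set U := extMap A e d w with hU
  -- The orthogonal complement of all eigenvectors v_x of U; it is invariant under U, and U maps it
  -- onto itself.
  let S : Submodule ℂ H :=
    (Submodule.span ℂ {v | ∃ x : ℝ, 1 + w * ⟪e, defVec A d x⟫_ℂ = 0 ∧ v = defVec A d x})ᗮ
  have hS : ∀ s, s ∈ S ↔
      ∀ x : ℝ, 1 + w * ⟪e, defVec A d x⟫_ℂ = 0 → ⟪defVec A d x, s⟫_ℂ = 0 := by
    intro s
    rw [Submodule.mem_orthogonal]
    constructor
    · exact fun h x hx => h _ (Submodule.subset_span ⟨x, hx, rfl⟩)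
    · intro h u hu
      induction hu using Submodule.span_induction with
      | mem u hu => obtain ⟨x, hx, rfl⟩ := hu; exact h x hx
      | zero => exact inner_zero_left _
      | add u v _ _ h1 h2 => rw [inner_add_left, h1, h2, add_zero]
      | smul c u _ h1 => rw [inner_smul_left, h1, mul_zero]
  have hUv : ∀ x : ℝ, 1 + w * ⟪e, defVec A d x⟫_ℂ = 0 → ∀ h,
      ⟪defVec A d x, U h⟫_ℂ = cay x * ⟪defVec A d x, h⟫_ℂ := by
    intro x hx h
    have h2 := hA.inner_extMap hT hw (defVec A d x) h
    rw [hA.extMap_defVec hT, hx, zero_smul, add_zero, inner_smul_left, ← hU] at h2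
    linear_combination cay x * h2 - ⟪defVec A d x, U h⟫_ℂ * conj_cay_mul_cay x
  have hUS : ∀ s ∈ S, U s ∈ S := fun s hs => (hS _).2 fun x hx => by
    rw [hUv x hx, (hS s).1 hs x hx, mul_zero]
  have : CompleteSpace S := (Submodule.isClosed_orthogonal _).completeSpace_coe
  let W : S →L[ℂ] S := (U.comp S.subtypeL).codRestrict S fun s => hUS s s.2
  have hW : ∀ s : S, (W s : H) = U s := fun s => rfl
  have hWsurj : Function.Surjective W := by
    intro k
    obtain ⟨h, hh⟩ := hA.extMap_surjective hw (k : H)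
    have hhS : h ∈ S := (hS _).2 fun x hx => by
      have h2 := hUv x hx h
      rw [hU, hh, (hS k).1 k.2 x hx] at h2
      exact (mul_eq_zero.1 h2.symm).resolve_left (cay_ne_zero x)
    exact ⟨⟨h, hhS⟩, Subtype.ext hh⟩
  have hW1 : W = 1 := by
    -- Every point of the circle other than 1 is some cay x. If x is an eigenvalue point, S is
    -- orthogonal to v_x and the equation is solved within {v_x}ᗮ; otherwise U - cay x is invertible
    -- on H.
    refine eq_one_of_forall_eigen W (fun a b => hA.inner_extMap hT hw a b) hWsurj ?_
    intro z hz hz1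
    obtain ⟨x, rfl⟩ := exists_cay_eq hz hz1
    constructor
    · intro t ht
      have h2 : U (t : H) = cay x • (t : H) := by
        exact congrArg Subtype.val ht
      by_cases hx : 1 + w * ⟪e, defVec A d x⟫_ℂ = 0
      · have h3 := hA.eq_smul_of_extMap_eq hT h2
        have h4 := (hS t).1 t.2 x hx
        have h5 : ⟪(t : H), t⟫_ℂ = 0 := by
          nth_rw 1 [h3]
          rw [inner_smul_left, h4, mul_zero]
        exact Subtype.ext (inner_self_eq_zero.1 h5 : (t : H) = 0)
      · exact Subtype.ext (hA.eq_zero_of_extMap_eq hT hx h2)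
    · intro k
      obtain ⟨h, hh, hhx⟩ : ∃ h, U h = cay x • h + k ∧
          (1 + w * ⟪e, defVec A d x⟫_ℂ = 0 → ⟪defVec A d x, h⟫_ℂ = 0) := by
        by_cases hx : 1 + w * ⟪e, defVec A d x⟫_ℂ = 0
        · obtain ⟨h, hh, hhx⟩ :=
            hA.exists_extMap_sub_of_inner_eq_zero hT hx ((hS k).1 k.2 x hx)
          exact ⟨h, hh, fun _ => hhx⟩
        · obtain ⟨h, hh⟩ := hA.exists_extMap_sub hT hx (k : H)
          exact ⟨h, hh, fun h0 => absurd h0 hx⟩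
      -- For y ≠ x, pairing the equation with v_y gives (cay y - cay x)⟨v_y, h⟩ = 0.
      have hhS : h ∈ S := (hS _).2 fun y hy => by
        by_cases hyx : y = x
        · subst hyx; exact hhx hy
        · have h2 := hUv y hy h
          rw [hh, inner_add_right, inner_smul_right, (hS k).1 k.2 y hy] at h2
          have h3 : (cay y - cay x) * ⟪defVec A d y, h⟫_ℂ = 0 := by linear_combination -h2
          exact (mul_eq_zero.1 h3).resolve_left (sub_ne_zero.2 fun h => hyx (cay_injective h))
      refine ⟨⟨h, hhS⟩, Subtype.ext ?_⟩
      exact hh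
  have hsS : s ∈ S := (hS s).2 hs
  apply h1
  have := hW ⟨s, hsS⟩
  rw [hW1] at this
  exact this.symm

end IsCayley

end DefectVectors

/-! ### Identification of U_θ, T_θ and σ(T_θ) in terms of A, e and d. -/

section Frame

variable {H : Type*} [NormedAddCommGroup H] [InnerProductSpace ℂ H]

/-- The data of the Cayley transform, together with its relation to the deficiency vectors. -/
structure IsCayleyFrame (T : H →ₗ.[ℂ] H) (φp φm e d : H) (A : H →L[ℂ] H) : Prop
    extends IsCayley T e d A where
  reg : IsRegularSimpleSymmetric T
  exists_scale : ∃ N : ℝ, 0 < N ∧ φp = (N : ℂ) • e ∧ φm = (N : ℂ) • d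

theorem exists_isCayleyFrame [CompleteSpace H] {T : H →ₗ.[ℂ] H} (hT : IsRegularSimpleSymmetric T)
    {φp φm : H} (hφ : IsDeficiencyPair T φp φm) :
    ∃ (e d : H) (A : H →L[ℂ] H), IsCayleyFrame T φp φm e d A := by
  obtain ⟨A, hA⟩ := exists_isCayley hT hφ
  have hN : (‖φp‖ : ℂ) ≠ 0 := by exact_mod_cast norm_ne_zero_iff.2 hφ.ne_zero
  exact ⟨_, _, A, { hA with
    reg := hT
    exists_scale := ⟨‖φp‖, norm_pos_iff.2 hφ.ne_zero,
      (smul_inv_smul₀ hN _).symm, (smul_inv_smul₀ hN _).symm⟩ }⟩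

/-- The number `e^{2πiθ}`. -/
def phaseExp (θ : ℝ) : ℂ := Complex.exp (2 * Real.pi * Complex.I * θ)

theorem conj_phaseExp_mul (θ : ℝ) : starRingEnd ℂ (phaseExp θ) * phaseExp θ = 1 := by
  rw [phaseExp, ← Complex.exp_conj, ← Complex.exp_add]
  simp [map_ofNat]

namespace IsCayleyFrame

variable {T : H →ₗ.[ℂ] H} {φp φm e d : H} {A : H →L[ℂ] H}

theorem mem_unitaryExtGraph (hF : IsCayleyFrame T φp φm e d A) {θ : ℝ} {g k : H} :
    (g, k) ∈ unitaryExtGraph T φp φm θ ↔ extMap A e d (phaseExp θ) g = k := by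
  have hA := hF.toIsCayley
  obtain ⟨N, hN, rfl, rfl⟩ := hF.exists_scale
  have hN0 : (N : ℂ) ≠ 0 := by exact_mod_cast hN.ne'
  rw [unitaryExtGraph, Submodule.mem_sup, extMap_apply]
  change (∃ y ∈ _, ∃ z ∈ Submodule.span ℂ {(_, phaseExp θ • _)}, _) ↔ _
  constructor
  · rintro ⟨_, ⟨⟨f, k'⟩, hfk, rfl⟩, z, hz, hyz⟩
    obtain ⟨c, rfl⟩ := Submodule.mem_span_singleton.1 hz
    obtain ⟨y, rfl, rfl⟩ := T.mem_graph_iff.1 hfk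
    have hg : T y + Complex.I • (y : H) + c • (N : ℂ) • e = g := congrArg Prod.fst hyz
    have hk : T y - Complex.I • (y : H) + c • phaseExp θ • (N : ℂ) • d = k :=
      congrArg Prod.snd hyz
    rw [← hg, ← hk, map_add, map_smul, map_smul, hA.map_e, hA.map_add, inner_add_right,
      hA.inner_e, inner_smul_right, inner_smul_right, hA.inner_e_self]
    module
  · rintro rfl
    obtain ⟨f, hf⟩ := hA.exists_pos (g - ⟪e, g⟫_ℂ • e) (by
      rw [inner_sub_right, inner_smul_right, hA.inner_e_self, mul_one, sub_self])
    refine ⟨_, ⟨(f, T f), T.mem_graph f, rfl⟩, (⟪e, g⟫_ℂ / N) • _,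
      Submodule.smul_mem _ _ (Submodule.mem_span_singleton_self _), ?_⟩
    refine Prod.ext ?_ ?_
    · change T f + Complex.I • (f : H) + (⟪e, g⟫_ℂ / N) • (N : ℂ) • e = g
      rw [hf, smul_smul, div_mul_cancel₀ _ hN0, sub_add_cancel]
    · change T f - Complex.I • (f : H) + (⟪e, g⟫_ℂ / N) • phaseExp θ • (N : ℂ) • d = _
      rw [← hA.map_add, hf, map_sub, map_smul, hA.map_e, smul_comm (phaseExp θ), smul_smul,
        div_mul_cancel₀ _ hN0]
      module

theorem mem_selfAdjointExtGraph (hF : IsCayleyFrame T φp φm e d A) {θ : ℝ} {f k : H} :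
    (f, k) ∈ selfAdjointExtGraph T φp φm θ ↔ ∃ g, g - extMap A e d (phaseExp θ) g = f ∧
      Complex.I • (g + extMap A e d (phaseExp θ) g) = k := by
  rw [selfAdjointExtGraph]
  constructor
  · rintro ⟨⟨g, k'⟩, hg, heq⟩
    obtain rfl := hF.mem_unitaryExtGraph.1 hg
    exact ⟨g, congrArg Prod.fst heq, congrArg Prod.snd heq⟩
  · rintro ⟨g, rfl, rfl⟩
    exact ⟨(g, _), hF.mem_unitaryExtGraph.2 rfl, rfl⟩

theorem extDefined_iff (hF : IsCayleyFrame T φp φm e d A) {θ : ℝ} :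
    ExtDefined T φp φm θ ↔ ∀ g, extMap A e d (phaseExp θ) g = g → g = 0 :=
  forall_congr' fun _ => by rw [hF.mem_unitaryExtGraph]

/-- If Ug = g, unitarity gives ⟨g, (T - i)f⟩ = ⟨g, (T + i)f⟩, so g is orthogonal to dom T. -/
theorem extDefined_of_dense (hF : IsCayleyFrame T φp φm e d A)
    (hT : Dense (T.domain : Set H)) (θ : ℝ) : ExtDefined T φp φm θ := by
  rw [hF.extDefined_iff]
  intro g hg
  refine hT.eq_zero_of_inner_left ℂ fun f hf => ?_
  have h1 := hF.inner_extMap hF.reg (conj_phaseExp_mul θ) g (T ⟨f, hf⟩ + Complex.I • f)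
  have h2 : extMap A e d (phaseExp θ) (T ⟨f, hf⟩ + Complex.I • f) = T ⟨f, hf⟩ - Complex.I • f := by
    rw [extMap_apply, hF.inner_e ⟨f, hf⟩, hF.map_add ⟨f, hf⟩, mul_zero, zero_smul, add_zero]
  rw [hg, h2, inner_sub_right, inner_add_right, inner_smul_right] at h1
  have h3 : (2 * Complex.I) * ⟪g, f⟫_ℂ = 0 := by linear_combination -h1
  simpa using h3

theorem phaseExp_eq_of_not_extDefined (hF : IsCayleyFrame T φp φm e d A) {θ₁ θ₂ : ℝ}
    (h₁ : ¬ ExtDefined T φp φm θ₁) (h₂ : ¬ ExtDefined T φp φm θ₂) :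
    phaseExp θ₁ = phaseExp θ₂ := by
  rw [hF.extDefined_iff] at h₁ h₂
  push Not at h₁ h₂
  obtain ⟨g₁, hg₁, hg₁0⟩ := h₁
  obtain ⟨g₂, hg₂, hg₂0⟩ := h₂
  exact hF.param_eq_of_extMap_eq_self hF.reg hg₁ hg₂ hg₁0 hg₂0

variable [CompleteSpace H]

/-- Parametrising the relation by g, with f = (1 - U)g, gives h = (x + i)(U - cay x)g. The resolvent
exists when U - cay x is invertible, and otherwise v_x is an eigenvector. No assumption on the
eigenvalue 1 enters, so relations are covered. -/
theorem mem_extSpectrum (hF : IsCayleyFrame T φp φm e d A) {θ x : ℝ} :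
    x ∈ extSpectrum T φp φm θ ↔ 1 + phaseExp θ * ⟪e, defVec A d x⟫_ℂ = 0 := by
  have hx := ofReal_add_I_ne_zero x
  set U := extMap A e d (phaseExp θ) with hU
  have hc : ((x : ℂ) + Complex.I) * cay x = x - Complex.I := by
    rw [cay, mul_div_cancel₀ _ hx]
  have hmem : ∀ f h : H, (f, h + (x : ℂ) • f) ∈ selfAdjointExtGraph T φp φm θ ↔
      ∃ g, g - U g = f ∧ ((x : ℂ) + Complex.I) • (U g - cay x • g) = h := by
    intro f h
    rw [hF.mem_selfAdjointExtGraph]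
    refine exists_congr fun g => and_congr_right fun hg => ?_
    have : Complex.I • (g + U g) - (x : ℂ) • f =
        ((x : ℂ) + Complex.I) • (U g - cay x • g) := by
      rw [← hg, smul_sub _ _ (cay x • g), smul_smul, hc]
      module
    rw [← this, sub_eq_iff_eq_add]
  rw [extSpectrum, realSpectrum, mem_ofPred_eq, not_iff_comm]
  constructor
  · intro h
    have hunit := hF.isUnit_extMap_sub hF.reg h
    set W := extMap A e d (phaseExp θ) - cay x • (1 : H →L[ℂ] H) with hW
    have hWa : ∀ g, W g = U g - cay x • g := fun g => rfl
    have hl : ∀ g, Ring.inverse W (W g) = g := fun g => by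
      change (Ring.inverse W * W) g = g
      rw [Ring.inverse_mul_cancel _ hunit]; rfl
    have hr : ∀ g, W (Ring.inverse W g) = g := fun g => by
      change (W * Ring.inverse W) g = g
      rw [Ring.mul_inverse_cancel _ hunit]; rfl
    -- The resolvent (T_θ - x)⁻¹ in terms of U.
    refine ⟨(((x : ℂ) + Complex.I)⁻¹) • ((1 - U) * Ring.inverse W), fun f h => ?_⟩
    rw [hmem]
    have hR : ∀ k, ((((x : ℂ) + Complex.I)⁻¹) • ((1 - U) * Ring.inverse W)) k =
      ((x : ℂ) + Complex.I)⁻¹ • (Ring.inverse W k - U (Ring.inverse W k)) := fun k => rfl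
    rw [hR]
    constructor
    · rintro ⟨g, rfl, rfl⟩
      rw [← hWa, map_smul, hl, map_smul, ← smul_sub, inv_smul_smul₀ hx]
    · rintro rfl
      refine ⟨((x : ℂ) + Complex.I)⁻¹ • Ring.inverse W h, ?_, ?_⟩
      · rw [map_smul, smul_sub]
      · rw [← hWa, map_smul, hr, smul_inv_smul₀ hx]
  · rintro ⟨R, hR⟩ h0
    have h1 := hF.extMap_defVec hF.reg (phaseExp θ) x
    rw [h0, zero_smul, add_zero] at h1
    have h2 := (hR (defVec A d x - U (defVec A d x)) 0).1 ((hmem _ _).2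
      ⟨defVec A d x, rfl, by rw [hU, h1, sub_self, smul_zero]⟩)
    rw [map_zero, hU, h1] at h2
    have h3 : (1 - cay x) • defVec A d x = 0 := by rw [sub_smul, one_smul, ← h2]
    rcases smul_eq_zero.1 h3 with h | h
    · exact cay_ne_one x (sub_eq_zero.1 h).symm
    · exact hF.defVec_ne_zero hF.reg x h

theorem exists_selfAdjointExt_eq (hF : IsCayleyFrame T φp φm e d A) {θ x : ℝ}
    (hθ : ExtDefined T φp φm θ) (hx : x ∈ extSpectrum T φp φm θ) {v : H}
    (hv : v ∈ adjKer T (x : ℂ)) :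
    ∃ h : v ∈ (selfAdjointExt T φp φm θ).domain,
      selfAdjointExt T φp φm θ ⟨v, h⟩ = (x : ℂ) • v := by
  rw [hF.mem_extSpectrum] at hx
  rw [hF.extDefined_iff] at hθ
  obtain ⟨c, rfl⟩ := (hF.mem_adjKer_iff hF.reg).1 hv
  have h1 := hF.extMap_defVec hF.reg (phaseExp θ) x
  rw [hx, zero_smul, add_zero] at h1
  have hfun : ∀ y ∈ selfAdjointExtGraph T φp φm θ, y.1 = 0 → y.2 = 0 := by
    rintro ⟨f, k⟩ hy h0
    obtain ⟨g, hg, hk⟩ := hF.mem_selfAdjointExtGraph.1 hy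
    have hg0 := hθ g (sub_eq_zero.1 (hg.trans h0)).symm
    rw [hg0, map_zero, add_zero, smul_zero] at hk
    exact hk.symm
  have h1c : 1 - cay x ≠ 0 := sub_ne_zero.2 (cay_ne_one x).symm
  have hmem : (c • defVec A d x, (x : ℂ) • c • defVec A d x) ∈
      selfAdjointExtGraph T φp φm θ := by
    rw [hF.mem_selfAdjointExtGraph]
    -- On the eigenvector, 1 - U is multiplication by 1 - cay x, so g is found by division.
    refine ⟨(c / (1 - cay x)) • defVec A d x, ?_, ?_⟩
    · rw [map_smul, h1, smul_smul, ← sub_smul]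
      congr 1
      field_simp
    · rw [map_smul, h1, smul_smul, ← add_smul, smul_smul, smul_smul]
      congr 1
      have hx := ofReal_add_I_ne_zero x
      have h2 : Complex.I * (1 + cay x) = x * (1 - cay x) := by
        rw [cay]; field_simp; ring
      field_simp
      linear_combination c * h2
  have hdom : c • defVec A d x ∈ (selfAdjointExt T φp φm θ).domain :=
    ⟨_, hmem, rfl⟩
  refine ⟨hdom, ?_⟩
  have h3 := Submodule.mem_graph_toLinearPMap hfun ⟨_, hdom⟩
  have h4 := (selfAdjointExtGraph T φp φm θ).sub_mem h3 hmem
  exact sub_eq_zero.1 (hfun _ h4 (sub_self _))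

theorem eq_zero_of_forall_extSpectrum (hF : IsCayleyFrame T φp φm e d A) {θ : ℝ}
    (hθ : ExtDefined T φp φm θ) {s : H}
    (hs : ∀ x ∈ extSpectrum T φp φm θ, ∀ v ∈ adjKer T (x : ℂ), ⟪v, s⟫_ℂ = 0) : s = 0 :=
  hF.eq_zero_of_forall_inner_eq_zero hF.reg (conj_phaseExp_mul θ) (hF.extDefined_iff.1 hθ)
    fun x hx => hs x (hF.mem_extSpectrum.2 hx) _
      ((hF.mem_adjKer_iff hF.reg).2 ⟨1, (one_smul ℂ _).symm⟩)

end IsCayleyFrame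

end Frame

/-! ### The smooth phase of ⟨e, v_x⟩ and its identification with τ. -/

section Phase

theorem hasDerivAt_cay (x : ℝ) :
    HasDerivAt cay (2 * Complex.I / ((x : ℂ) + Complex.I) ^ 2) x := by
  have h0 : HasDerivAt (fun y : ℝ => (y : ℂ)) 1 x := Complex.ofRealCLM.hasDerivAt
  have h := (h0.sub_const Complex.I).div (h0.add_const Complex.I) (ofReal_add_I_ne_zero x)
  exact h.congr_deriv (by ring)

theorem contDiff_cay : ContDiff ℝ ∞ cay :=
  (Complex.ofRealCLM.contDiff.sub contDiff_const).mul
    ((Complex.ofRealCLM.contDiff.add contDiff_const).inv ofReal_add_I_ne_zero)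

/-- The number of points in `(a, b]` at which a continuous strictly increasing function takes
integer values. -/
theorem ncard_intValued {τ : ℝ → ℝ} (hτ : StrictMono τ) (hc : Continuous τ) {a b : ℝ}
    (hab : a ≤ b) :
    (({x | ∃ n : ℤ, τ x = n} ∩ Ioc a b).ncard : ℝ) = (⌊τ b⌋ : ℝ) - ⌊τ a⌋ := by
  have hinj : InjOn (fun y => ⌊τ y⌋) ({x | ∃ n : ℤ, τ x = n} ∩ Ioc a b) := by
    rintro x ⟨⟨n, hn⟩, -⟩ y ⟨⟨m, hm⟩, -⟩ hxy
    simp only [hn, hm, Int.floor_intCast] at hxy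
    exact hτ.injective (by rw [hn, hm, hxy])
  -- The floor of τ is a bijection onto the integers in (⌊τ a⌋, ⌊τ b⌋]; excluding a matches
  -- excluding ⌊τ a⌋, also when τ a is an integer.
  have himg : (fun y => ⌊τ y⌋) '' ({x | ∃ n : ℤ, τ x = n} ∩ Ioc a b) =
      (Finset.Ioc ⌊τ a⌋ ⌊τ b⌋ : Set ℤ) := by
    ext k
    simp only [mem_image, Finset.coe_Ioc, mem_Ioc]
    constructor
    · rintro ⟨x, ⟨⟨n, hn⟩, hax, hxb⟩, rfl⟩
      refine ⟨?_, Int.floor_mono (hτ.monotone hxb)⟩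
      rw [Int.floor_lt, hn, Int.floor_intCast, ← hn]
      exact hτ hax
    · rintro ⟨h1, h2⟩
      rw [Int.floor_lt] at h1
      rw [Int.le_floor] at h2
      obtain ⟨x, hx, hxk⟩ := intermediate_value_Icc hab hc.continuousOn ⟨h1.le, h2⟩
      refine ⟨x, ⟨⟨k, hxk⟩, lt_of_le_of_ne hx.1 ?_, hx.2⟩, by simp [hxk]⟩
      rintro rfl
      exact h1.ne hxk
  rw [← hinj.ncard_image, himg, ncard_coe_finset, Int.card_Ioc]
  have h : ⌊τ a⌋ ≤ ⌊τ b⌋ := Int.floor_mono (hτ.monotone hab)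
  have h2 : (((⌊τ b⌋ - ⌊τ a⌋).toNat : ℤ) : ℝ) = ((⌊τ b⌋ - ⌊τ a⌋ : ℤ) : ℝ) := by
    rw [Int.toNat_of_nonneg (by omega)]
  push_cast at h2
  exact_mod_cast h2

variable {H : Type*} [NormedAddCommGroup H] [InnerProductSpace ℂ H]

/-- The derivative `‖v_x‖² / (π (1 + x²))` of the phase function. -/
def phaseRate (A : H →L[ℂ] H) (d : H) (x : ℝ) : ℝ :=
  ‖defVec A d x‖ ^ 2 / (Real.pi * (1 + x ^ 2))

namespace IsCayleyFrame

variable [CompleteSpace H] {T : H →ₗ.[ℂ] H} {φp φm e d : H} {A : H →L[ℂ] H}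

theorem contDiff_defVec (hF : IsCayleyFrame T φp φm e d A) : ContDiff ℝ ∞ (defVec A d) := by
  have h1 : ContDiff ℝ ∞ fun x => Ring.inverse (A - cay x • (1 : H →L[ℂ] H)) := by
    rw [contDiff_iff_contDiffAt]
    intro x
    obtain ⟨u, hu⟩ := hF.isUnit_sub hF.reg x
    have h2 : ContDiffAt ℝ ∞ Ring.inverse (A - cay x • (1 : H →L[ℂ] H)) := by
      rw [← hu]; exact contDiffAt_ringInverse ℝ u
    exact h2.comp x (contDiffAt_const.sub (contDiff_cay.contDiffAt.smul contDiffAt_const))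
  exact ((ContinuousLinearMap.apply ℂ H d).restrictScalars ℝ).contDiff.comp h1

theorem contDiff_phaseRate (hF : IsCayleyFrame T φp φm e d A) :
    ContDiff ℝ ∞ (phaseRate A d) := by
  refine (hF.contDiff_defVec.norm_sq ℂ).div (by fun_prop) fun x => ?_
  positivity

theorem phaseRate_pos (hF : IsCayleyFrame T φp φm e d A) (x : ℝ) : 0 < phaseRate A d x := by
  have := norm_pos_iff.2 (hF.defVec_ne_zero hF.reg x)
  rw [phaseRate]
  positivity

/-- Differentiate `gram_defVec` in y at y = x. The factor in front of ⟨v_x, v_y⟩ vanishes there, so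
the derivative of v never enters the left side, and only cay' and ‖v_x‖² survive. -/
theorem hasDerivAt_inner_defVec (hF : IsCayleyFrame T φp φm e d A) (x : ℝ) :
    HasDerivAt (fun y => ⟪e, defVec A d y⟫_ℂ)
      (-(2 * Real.pi * Complex.I * phaseRate A d x) * ⟪e, defVec A d x⟫_ℂ) x := by
  have hv : HasDerivAt (defVec A d) (deriv (defVec A d) x) x :=
    ((hF.contDiff_defVec.differentiable (by simp)) x).hasDerivAt
  have hβ : HasDerivAt (fun y => ⟪e, defVec A d y⟫_ℂ) ⟪e, deriv (defVec A d) x⟫_ℂ x := by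
    have := (hasDerivAt_const x e).inner ℂ hv
    simpa using this
  convert hβ using 1
  have hg : HasDerivAt (fun y => ⟪defVec A d x, defVec A d y⟫_ℂ)
      ⟪defVec A d x, deriv (defVec A d) x⟫_ℂ x := by
    have := (hasDerivAt_const x (defVec A d x)).inner ℂ hv
    simpa using this
  have h1 := (((hasDerivAt_cay x).const_mul (starRingEnd ℂ (cay x))).sub_const 1).mul hg
  have h2 := (hβ.const_mul (starRingEnd ℂ ⟪e, defVec A d x⟫_ℂ)).const_sub 1
  have h3 : (fun y => 1 - starRingEnd ℂ ⟪e, defVec A d x⟫_ℂ * ⟪e, defVec A d y⟫_ℂ) =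
      (fun y => starRingEnd ℂ (cay x) * cay y - 1) *
        fun y => ⟪defVec A d x, defVec A d y⟫_ℂ :=
    funext fun y => (hF.gram_defVec hF.reg x y).symm
  rw [h3] at h2
  have h4 := h1.unique h2
  rw [conj_cay_mul_cay, sub_self, zero_mul, add_zero, inner_self_eq_norm_sq_to_K] at h4
  have h5 := hF.conj_inner_mul_inner hF.reg x
  have hx1 := ofReal_add_I_ne_zero x
  have hx2 := ofReal_sub_I_ne_zero x
  have hx3 : ((x : ℂ) + Complex.I) * (x - Complex.I) = 1 + (x : ℂ) ^ 2 := by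
    linear_combination -Complex.I_sq
  have hx4 : (1 + (x : ℂ) ^ 2) ≠ 0 := hx3 ▸ mul_ne_zero hx1 hx2
  have h6 : starRingEnd ℂ (cay x) * (2 * Complex.I / ((x : ℂ) + Complex.I) ^ 2) =
      2 * Complex.I / (1 + (x : ℂ) ^ 2) := by
    rw [conj_cay, cay, ← hx3]
    field_simp
  rw [h6] at h4
  have hπ : (Real.pi : ℂ) ≠ 0 := by exact_mod_cast Real.pi_ne_zero
  have h7 : (2 * Real.pi * Complex.I * phaseRate A d x : ℂ) =
      2 * Complex.I / (1 + (x : ℂ) ^ 2) * (‖defVec A d x‖ : ℂ) ^ 2 := by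
    rw [phaseRate]
    push_cast
    field_simp
  rw [h7]
  have h8 : 2 * Complex.I / (1 + (x : ℂ) ^ 2) * (‖defVec A d x‖ : ℂ) ^ 2 =
      -(starRingEnd ℂ ⟪e, defVec A d x⟫_ℂ * ⟪e, deriv (defVec A d) x⟫_ℂ) := h4
  rw [h8]
  linear_combination ⟪e, deriv (defVec A d) x⟫_ℂ * h5

/-- A smooth phase of `⟪e, v_x⟫`. -/
theorem exists_phaseLift (hF : IsCayleyFrame T φp φm e d A) {p : ℝ}
    (hp : p ∈ extSpectrum T φp φm 0) :
    ∃ τ : ℝ → ℝ, ContDiff ℝ ∞ τ ∧ τ p = 0 ∧ (∀ x, HasDerivAt τ (phaseRate A d x) x) ∧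
      ∀ x, phaseExp (τ x) * ⟪e, defVec A d x⟫_ℂ = -1 := by
  have hcont : Continuous (phaseRate A d) := hF.contDiff_phaseRate.continuous
  have hder : ∀ x, HasDerivAt (fun x => ∫ t in p..x, phaseRate A d t) (phaseRate A d x) x :=
    fun x => intervalIntegral.integral_hasDerivAt_right (hcont.intervalIntegrable _ _)
      hcont.stronglyMeasurable.stronglyMeasurableAtFilter hcont.continuousAt
  refine ⟨fun x => ∫ t in p..x, phaseRate A d t, ?_, by simp, hder, ?_⟩
  · rw [contDiff_infty_iff_deriv]
    refine ⟨fun x => (hder x).differentiableAt, ?_⟩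
    have : deriv (fun x => ∫ t in p..x, phaseRate A d t) = phaseRate A d :=
      funext fun x => (hder x).deriv
    rw [this]
    exact hF.contDiff_phaseRate
  · set τ := fun x => ∫ t in p..x, phaseRate A d t with hτ
    -- The two factors rotate at opposite rates, so the product is constant; at p it is -1 because p
    -- ∈ σ(T_0).
    have h1 : ∀ x, HasDerivAt (fun y => phaseExp (τ y) * ⟪e, defVec A d y⟫_ℂ) 0 x := by
      intro x
      have h2 : HasDerivAt (fun y => phaseExp (τ y))
          (phaseExp (τ x) * (2 * Real.pi * Complex.I * phaseRate A d x)) x :=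
        ((hder x).ofReal_comp.const_mul _).cexp
      exact (h2.mul (hF.hasDerivAt_inner_defVec x)).congr_deriv (by ring)
    intro x
    have h3 := is_const_of_deriv_eq_zero (fun x => (h1 x).differentiableAt)
      (fun x => (h1 x).deriv) x p
    rw [h3]
    have h4 : τ p = 0 := by simp [hτ]
    rw [h4]
    linear_combination hF.mem_extSpectrum.1 hp

theorem mem_extSpectrum_iff_phase (hF : IsCayleyFrame T φp φm e d A) {τ : ℝ → ℝ}
    (hτ : ∀ x, phaseExp (τ x) * ⟪e, defVec A d x⟫_ℂ = -1) {θ x : ℝ} :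
    x ∈ extSpectrum T φp φm θ ↔ ∃ n : ℤ, τ x = n + θ := by
  have h1 : phaseExp θ = phaseExp (θ - τ x) * phaseExp (τ x) := by
    rw [phaseExp, phaseExp, phaseExp, ← Complex.exp_add]
    congr 1
    push_cast
    ring
  rw [hF.mem_extSpectrum, h1, mul_assoc, hτ]
  have h2 : 1 + phaseExp (θ - τ x) * -1 = 0 ↔ phaseExp (θ - τ x) = 1 := by
    constructor <;> intro h <;> linear_combination -h
  rw [h2, phaseExp, Complex.exp_eq_one_iff]
  have hpi : (2 * Real.pi * Complex.I : ℂ) ≠ 0 := by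
    simp [Real.pi_ne_zero]
  constructor
  · rintro ⟨n, hn⟩
    refine ⟨-n, ?_⟩
    rw [mul_comm, mul_left_inj' hpi] at hn
    have : θ - τ x = n := by exact_mod_cast hn
    push_cast
    linarith
  · rintro ⟨n, hn⟩
    refine ⟨-n, ?_⟩
    rw [hn]
    push_cast
    ring

/-- By the previous criterion σ(T_0) is where τ is an integer, and the only admissible θ at x is the
fractional part of τ x. The signed count is ⌊τ x⌋ on either side of p, since τ p = 0. -/
theorem phase_eq (hF : IsCayleyFrame T φp φm e d A) {τ : ℝ → ℝ} (hmono : StrictMono τ)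
    (hc : Continuous τ) {p : ℝ} (hp : τ p = 0)
    (hτ : ∀ x, phaseExp (τ x) * ⟪e, defVec A d x⟫_ℂ = -1) : phase T φp φm p = τ := by
  funext x
  have hset : extSpectrum T φp φm 0 = {x | ∃ n : ℤ, τ x = n} := by
    ext y
    rw [hF.mem_extSpectrum_iff_phase hτ]
    simp
  have hinf : {θ : ℝ | θ ∈ Ico 0 1 ∧ x ∈ extSpectrum T φp φm θ} = {Int.fract (τ x)} := by
    ext θ
    simp only [mem_ofPred_eq, mem_singleton_iff, hF.mem_extSpectrum_iff_phase hτ]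
    constructor
    · rintro ⟨h, n, hn⟩
      rw [hn, Int.fract_intCast_add, Int.fract_eq_self.2 h]
    · rintro rfl
      exact ⟨⟨Int.fract_nonneg _, Int.fract_lt_one _⟩, ⌊τ x⌋, (Int.floor_add_fract _).symm⟩
  rw [phase, hset, hinf, csInf_singleton]
  rcases le_total p x with h | h
  · rw [ncard_intValued hmono hc h, hp, Ioc_eq_empty_of_le h, inter_empty, ncard_empty]
    have := Int.floor_add_fract (τ x)
    simp only [Int.floor_zero]
    push_cast
    linarith
  · rw [ncard_intValued hmono hc h, hp, Ioc_eq_empty_of_le h, inter_empty, ncard_empty]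
    have := Int.floor_add_fract (τ x)
    simp only [Int.floor_zero]
    push_cast
    linarith

theorem exists_phase (hF : IsCayleyFrame T φp φm e d A) {p : ℝ}
    (hp : p ∈ extSpectrum T φp φm 0) :
    ContDiff ℝ ∞ (phase T φp φm p) ∧
      (∀ x, HasDerivAt (phase T φp φm p) (phaseRate A d x) x) ∧
      ∀ x, phaseExp (phase T φp φm p x) * ⟪e, defVec A d x⟫_ℂ = -1 := by
  obtain ⟨τ, h1, h2, h3, h4⟩ := hF.exists_phaseLift hp
  have hmono : StrictMono τ := strictMono_of_hasDerivAt_pos h3 hF.phaseRate_pos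
  rw [hF.phase_eq hmono h1.continuous h2 h4]
  exact ⟨h1, h3, h4⟩

end IsCayleyFrame

end Phase

/-! ### The normalised vectors φ_x and the closed form of their Gram matrix. -/

section Model

variable {H : Type*} [NormedAddCommGroup H] [InnerProductSpace ℂ H]

/-- The number `e^{πiθ}`. -/
def halfExp (θ : ℝ) : ℂ := Complex.exp (Real.pi * Complex.I * θ)

theorem halfExp_ne_zero (θ : ℝ) : halfExp θ ≠ 0 := Complex.exp_ne_zero _

theorem phaseExp_eq_sq (θ : ℝ) : phaseExp θ = halfExp θ ^ 2 := by
  rw [phaseExp, halfExp, ← Complex.exp_nat_mul]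
  congr 1
  push_cast
  ring

theorem conj_halfExp (θ : ℝ) : starRingEnd ℂ (halfExp θ) = (halfExp θ)⁻¹ := by
  rw [halfExp, ← Complex.exp_conj, ← Complex.exp_neg]
  simp

theorem norm_halfExp (θ : ℝ) : ‖halfExp θ‖ = 1 := by
  rw [halfExp, show (Real.pi * Complex.I * θ : ℂ) = ((Real.pi * θ : ℝ) : ℂ) * Complex.I by
    push_cast; ring, Complex.norm_exp_ofReal_mul_I]

theorem two_I_mul_sin (a b : ℝ) : 2 * Complex.I * (Real.sin (Real.pi * (a - b)) : ℂ) =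
    halfExp a / halfExp b - halfExp b / halfExp a := by
  rw [Complex.ofReal_sin, Complex.sin, halfExp, halfExp, ← Complex.exp_sub, ← Complex.exp_sub]
  have h1 : (-((Real.pi * (a - b) : ℝ) : ℂ) * Complex.I) =
    Real.pi * Complex.I * b - Real.pi * Complex.I * a := by push_cast; ring
  have h2 : (((Real.pi * (a - b) : ℝ) : ℂ) * Complex.I) =
    Real.pi * Complex.I * a - Real.pi * Complex.I * b := by push_cast; ring
  rw [h1, h2]
  linear_combination (Complex.exp (Real.pi * Complex.I * b - Real.pi * Complex.I * a) -
    Complex.exp (Real.pi * Complex.I * a - Real.pi * Complex.I * b)) * Complex.I_sq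

theorem norm_ofReal_add_I (x : ℝ) : ‖(x : ℂ) + Complex.I‖ = √(1 + x ^ 2) := by
  rw [Complex.norm_def, Complex.normSq_apply]
  congr 1
  simp
  ring

/-- The coefficient of `φ_x` with respect to `v_x`. -/
def modelCoeff (A : H →L[ℂ] H) (d : H) (t x : ℝ) : ℂ :=
  -((√(1 + x ^ 2) / ‖defVec A d x‖ : ℝ) : ℂ) * (halfExp t / ((x : ℂ) + Complex.I))

namespace IsCayleyFrame

variable [CompleteSpace H] {T : H →ₗ.[ℂ] H} {φp φm e d : H} {A : H →L[ℂ] H}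

/-- In the line through v_x the unit norm fixes the modulus of the coefficient, and the positivity
condition fixes its phase, since ⟨v_x, e⟩ = -e^{2πiτ(x)}. -/
theorem isModelVec_iff (hF : IsCayleyFrame T φp φm e d A) {p : ℝ}
    (hp : p ∈ extSpectrum T φp φm 0) {x : ℝ} {w : H} : IsModelVec T φp φm p x w ↔
      w = modelCoeff A d (phase T φp φm p x) x • defVec A d x := by
  obtain ⟨-, -, hτ⟩ := hF.exists_phase hp
  have hβ : ⟪defVec A d x, e⟫_ℂ = -halfExp (phase T φp φm p x) ^ 2 := by
    have h1 := hτ x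
    have h2 := hF.conj_inner_mul_inner hF.reg x
    rw [phaseExp_eq_sq] at h1
    rw [inner_conj_symm] at h2
    linear_combination ⟪defVec A d x, e⟫_ℂ * h1 - halfExp (phase T φp φm p x) ^ 2 * h2
  obtain ⟨N, hN, rfl, -⟩ := hF.exists_scale
  set t := phase T ((N : ℂ) • e) φm p x with ht
  set v := defVec A d x with hv
  have hv0 : 0 < ‖v‖ := norm_pos_iff.2 (hF.defVec_ne_zero hF.reg x)
  have hE := halfExp_ne_zero t
  have hx1 := ofReal_add_I_ne_zero x
  have hx2 := ofReal_sub_I_ne_zero x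
  have hN0 : (N : ℂ) ≠ 0 := by exact_mod_cast hN.ne'
  have hs : 0 < √(1 + x ^ 2) := by positivity
  have hconj : starRingEnd ℂ ((x : ℂ) - Complex.I) = x + Complex.I := by simp
  have hconj' : starRingEnd ℂ ((x : ℂ) + Complex.I) = x - Complex.I := by
    simp [sub_eq_add_neg]
  constructor
  · rintro ⟨h1, h2, r, hr, h3⟩
    obtain ⟨c, rfl⟩ := (hF.mem_adjKer_iff hF.reg).1 h1
    rw [inner_smul_left, inner_smul_right, hβ] at h3
    change _ = (r : ℂ) * halfExp t at h3
    have h4 : starRingEnd ℂ c = -((r / N : ℝ) : ℂ) * ((halfExp t)⁻¹ / ((x : ℂ) - Complex.I)) := by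
      push_cast
      field_simp
      have : halfExp t * ((x - Complex.I) * (starRingEnd ℂ c * (N * -halfExp t))) =
        halfExp t * r := by linear_combination h3
      have := mul_left_cancel₀ hE this
      linear_combination -this
    have h5 : c = -((r / N : ℝ) : ℂ) * (halfExp t / ((x : ℂ) + Complex.I)) := by
      have := congrArg (starRingEnd ℂ) h4
      rw [Complex.conj_conj] at this
      rw [this, map_mul, map_neg, Complex.conj_ofReal, map_div₀, hconj, map_inv₀, conj_halfExp,
        inv_inv]
    have h6 : r / N = √(1 + x ^ 2) / ‖v‖ := by
      rw [norm_smul, h5, norm_mul, norm_neg, norm_div, norm_halfExp, norm_ofReal_add_I,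
        Complex.norm_real, Real.norm_of_nonneg (by positivity)] at h2
      rw [eq_div_iff hv0.ne']
      field_simp at h2
      field_simp
      linarith
    rw [h5, h6, modelCoeff]
  · rintro rfl
    refine ⟨(hF.mem_adjKer_iff hF.reg).2 ⟨_, rfl⟩, ?_, √(1 + x ^ 2) / ‖v‖ * N, by positivity, ?_⟩
    · rw [norm_smul, modelCoeff, norm_mul, norm_neg, norm_div, norm_halfExp, norm_ofReal_add_I,
        Complex.norm_real, Real.norm_of_nonneg (by positivity), ← hv]
      field_simp
    · change _ = _ * halfExp t
      rw [inner_smul_left, inner_smul_right, hβ, modelCoeff, ← hv, map_mul, map_neg,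
        Complex.conj_ofReal, map_div₀, hconj', conj_halfExp]
      push_cast
      field_simp

theorem isModelVec_iff_eq (hF : IsCayleyFrame T φp φm e d A) {p : ℝ}
    (hp : p ∈ extSpectrum T φp φm 0) {x : ℝ} {w : H} :
    IsModelVec T φp φm p x w ↔ w = modelVec T φp φm p x := by
  have h : ∃ v, IsModelVec T φp φm p x v := ⟨_, (hF.isModelVec_iff hp).2 rfl⟩
  have h1 : IsModelVec T φp φm p x (modelVec T φp φm p x) := by
    rw [modelVec, dif_pos h]; exact h.choose_spec
  rw [hF.isModelVec_iff hp, (hF.isModelVec_iff hp).1 h1]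

theorem modelVec_eq (hF : IsCayleyFrame T φp φm e d A) {p : ℝ}
    (hp : p ∈ extSpectrum T φp φm 0) (x : ℝ) : modelVec T φp φm p x =
      modelCoeff A d (phase T φp φm p x) x • defVec A d x :=
  (hF.isModelVec_iff hp).1 ((hF.isModelVec_iff_eq hp).2 rfl)

theorem continuous_modelVec (hF : IsCayleyFrame T φp φm e d A) {p : ℝ}
    (hp : p ∈ extSpectrum T φp φm 0) : Continuous (modelVec T φp φm p) := by
  have h1 : modelVec T φp φm p = fun x =>
      modelCoeff A d (phase T φp φm p x) x • defVec A d x := funext (hF.modelVec_eq hp)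
  have hτ := (hF.exists_phase hp).1.continuous
  have hv := hF.contDiff_defVec.continuous
  rw [h1]
  refine Continuous.smul (.mul (.neg (Complex.continuous_ofReal.comp
    (.div (by fun_prop) hv.norm fun x => norm_ne_zero_iff.2 (hF.defVec_ne_zero hF.reg x))))
    (.div ?_ (by fun_prop) ofReal_add_I_ne_zero)) hv
  unfold halfExp
  fun_prop

/-- With β = -e^{-2πiτ}, the right side of `gram_defVec` is 1 - e^{2πi(τ(x) - τ(y))}. The half-angle
phases in `modelCoeff` make it a real sine, and the norms of v_x, v_y become the square roots of τ'.
-/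
theorem inner_modelVec (hF : IsCayleyFrame T φp φm e d A) {p : ℝ}
    (hp : p ∈ extSpectrum T φp φm 0) {x y : ℝ} (hxy : x ≠ y) :
    ⟪modelVec T φp φm p x, modelVec T φp φm p y⟫_ℂ =
      ((Real.sin (Real.pi * (phase T φp φm p x - phase T φp φm p y)) /
        (Real.pi * (x - y) * √(deriv (phase T φp φm p) x) * √(deriv (phase T φp φm p) y)) : ℝ) :
          ℂ) := by
  obtain ⟨-, hder, hτ⟩ := hF.exists_phase hp
  have hβ : ∀ x, ⟪e, defVec A d x⟫_ℂ = -(halfExp (phase T φp φm p x) ^ 2)⁻¹ := by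
    intro x
    have h1 := hτ x
    rw [phaseExp_eq_sq] at h1
    have h2 := halfExp_ne_zero (phase T φp φm p x)
    field_simp
    linear_combination h1
  have hg := hF.gram_defVec hF.reg x y
  rw [hβ, hβ, map_neg, map_inv₀, map_pow, conj_halfExp, conj_cay] at hg
  have hs := two_I_mul_sin (phase T φp φm p x) (phase T φp φm p y)
  rw [hF.modelVec_eq hp, hF.modelVec_eq hp, inner_smul_left, inner_smul_right, (hder x).deriv,
    (hder y).deriv]
  have hrate : ∀ x, √(phaseRate A d x) = ‖defVec A d x‖ / (√Real.pi * √(1 + x ^ 2)) := by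
    intro x
    rw [phaseRate, Real.sqrt_div (sq_nonneg _), Real.sqrt_sq (norm_nonneg _),
      Real.sqrt_mul Real.pi_pos.le]
  rw [hrate, hrate]
  have hden : Real.pi * (x - y) * (‖defVec A d x‖ / (√Real.pi * √(1 + x ^ 2))) *
      (‖defVec A d y‖ / (√Real.pi * √(1 + y ^ 2))) =
      (x - y) * (‖defVec A d x‖ * ‖defVec A d y‖) / (√(1 + x ^ 2) * √(1 + y ^ 2)) := by
    have h1 : √Real.pi * √Real.pi = Real.pi := Real.mul_self_sqrt Real.pi_pos.le
    have h2 : 0 < √(1 + x ^ 2) := by positivity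
    have h3 : 0 < √(1 + y ^ 2) := by positivity
    have h4 : 0 < √Real.pi := by positivity
    field_simp
    linear_combination -(‖defVec A d x‖ * ‖defVec A d y‖) * h1
  rw [hden]
  have hconj' : starRingEnd ℂ ((x : ℂ) + Complex.I) = x - Complex.I := by
    simp [sub_eq_add_neg]
  rw [modelCoeff, modelCoeff, map_mul, map_neg, Complex.conj_ofReal, map_div₀, hconj',
    conj_halfExp]
  rw [cay, cay] at hg
  push_cast
  set S := Complex.sin (Real.pi * (phase T φp φm p x - phase T φp φm p y)) with hS
  have hs' : 2 * Complex.I * S = halfExp (phase T φp φm p x) / halfExp (phase T φp φm p y) -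
      halfExp (phase T φp φm p y) / halfExp (phase T φp φm p x) := by
    rw [← hs, hS]; push_cast; rfl
  have hEx := halfExp_ne_zero (phase T φp φm p x)
  have hEy := halfExp_ne_zero (phase T φp φm p y)
  set Ex := halfExp (phase T φp φm p x)
  set Ey := halfExp (phase T φp φm p y)
  set g := ⟪defVec A d x, defVec A d y⟫_ℂ
  have hnx : (‖defVec A d x‖ : ℂ) ≠ 0 := by
    exact_mod_cast norm_ne_zero_iff.2 (hF.defVec_ne_zero hF.reg x)
  have hny : (‖defVec A d y‖ : ℂ) ≠ 0 := by
    exact_mod_cast norm_ne_zero_iff.2 (hF.defVec_ne_zero hF.reg y)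
  have hsx : (√(1 + x ^ 2) : ℂ) ≠ 0 := by
    have : 0 < √(1 + x ^ 2) := by positivity
    exact_mod_cast this.ne'
  have hsy : (√(1 + y ^ 2) : ℂ) ≠ 0 := by
    have : 0 < √(1 + y ^ 2) := by positivity
    exact_mod_cast this.ne'
  have hxyc : (x : ℂ) - y ≠ 0 := sub_ne_zero.2 (by exact_mod_cast hxy)
  have hx1 := ofReal_add_I_ne_zero x
  have hx2 := ofReal_sub_I_ne_zero x
  have hy1 := ofReal_add_I_ne_zero y
  have h2I : (2 * Complex.I) ≠ 0 := by simp
  have hgg : g * (x - y) * Ey = S * Ex * (x - Complex.I) * (y + Complex.I) := by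
    apply mul_left_cancel₀ h2I
    apply mul_left_cancel₀ hEy
    field_simp at hg hs'
    linear_combination -hg - (x - Complex.I) * (y + Complex.I) * hs'
  field_simp
  linear_combination hgg

end IsCayleyFrame

end Model

/-! ### Orthonormal bases at the sampling points and the series for the kernel. -/

section Sampling

variable {H : Type*} [NormedAddCommGroup H] [InnerProductSpace ℂ H]

theorem phase_samplePt {T : H →ₗ.[ℂ] H} {φp φm : H} {p θ : ℝ} (n : SampleIdx T φp φm p θ) :
    phase T φp φm p (samplePt T φp φm p θ n) = n.1 + θ :=
  Function.invFun_eq n.2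

theorem samplePt_injective {T : H →ₗ.[ℂ] H} {φp φm : H} {p θ : ℝ} :
    Function.Injective (samplePt T φp φm p θ) := by
  intro n m h
  have := congrArg (phase T φp φm p) h
  rw [phase_samplePt, phase_samplePt, add_left_inj, Int.cast_inj] at this
  exact Subtype.ext this

theorem samplePt_eq {T : H →ₗ.[ℂ] H} {φp φm : H} {p θ x : ℝ}
    (hinj : Function.Injective (phase T φp φm p)) (n : SampleIdx T φp φm p θ)
    (hx : phase T φp φm p x = n.1 + θ) : samplePt T φp φm p θ n = x :=
  hinj (by rw [phase_samplePt, hx])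

namespace IsCayleyFrame

variable [CompleteSpace H] {T : H →ₗ.[ℂ] H} {φp φm e d : H} {A : H →L[ℂ] H}

theorem deriv_phase_pos (hF : IsCayleyFrame T φp φm e d A) {p : ℝ}
    (hp : p ∈ extSpectrum T φp φm 0) (x : ℝ) : 0 < deriv (phase T φp φm p) x := by
  rw [((hF.exists_phase hp).2.1 x).deriv]
  exact hF.phaseRate_pos x

theorem strictMono_phase (hF : IsCayleyFrame T φp φm e d A) {p : ℝ}
    (hp : p ∈ extSpectrum T φp φm 0) : StrictMono (phase T φp φm p) :=
  strictMono_of_deriv_pos (hF.deriv_phase_pos hp)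

theorem mem_extSpectrum_iff (hF : IsCayleyFrame T φp φm e d A) {p : ℝ}
    (hp : p ∈ extSpectrum T φp φm 0) {θ x : ℝ} :
    x ∈ extSpectrum T φp φm θ ↔ ∃ n : ℤ, phase T φp φm p x = n + θ :=
  hF.mem_extSpectrum_iff_phase (hF.exists_phase hp).2.2

theorem isModelVec_modelVec (hF : IsCayleyFrame T φp φm e d A) {p : ℝ}
    (hp : p ∈ extSpectrum T φp φm 0) (x : ℝ) :
    IsModelVec T φp φm p x (modelVec T φp φm p x) :=
  (hF.isModelVec_iff_eq hp).2 rfl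

theorem inner_modelVec_self (hF : IsCayleyFrame T φp φm e d A) {p : ℝ}
    (hp : p ∈ extSpectrum T φp φm 0) (x : ℝ) :
    ⟪modelVec T φp φm p x, modelVec T φp φm p x⟫_ℂ = 1 := by
  rw [inner_self_eq_norm_sq_to_K, (hF.isModelVec_modelVec hp x).2.1]
  simp

theorem samplePt_mem_extSpectrum (hF : IsCayleyFrame T φp φm e d A) {p θ : ℝ}
    (hp : p ∈ extSpectrum T φp φm 0) (n : SampleIdx T φp φm p θ) :
    samplePt T φp φm p θ n ∈ extSpectrum T φp φm θ :=
  (hF.mem_extSpectrum_iff hp).2 ⟨n.1, phase_samplePt n⟩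

theorem exists_samplePt (hF : IsCayleyFrame T φp φm e d A) {p θ x : ℝ}
    (hp : p ∈ extSpectrum T φp φm 0) (hx : x ∈ extSpectrum T φp φm θ) :
    ∃ n, samplePt T φp φm p θ n = x := by
  obtain ⟨n, hn⟩ := (hF.mem_extSpectrum_iff hp).1 hx
  exact ⟨⟨n, x, hn⟩, samplePt_eq (hF.strictMono_phase hp).injective _ hn⟩

theorem orthonormal_modelVec (hF : IsCayleyFrame T φp φm e d A) {p : ℝ}
    (hp : p ∈ extSpectrum T φp φm 0) (θ : ℝ) :
    Orthonormal ℂ fun n => modelVec T φp φm p (samplePt T φp φm p θ n) := by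
  refine ⟨fun n => (hF.isModelVec_modelVec hp _).2.1, fun n m hnm => ?_⟩
  change ⟪modelVec T φp φm p _, modelVec T φp φm p _⟫_ℂ = 0
  rw [hF.inner_modelVec hp (fun h => hnm (samplePt_injective h)), phase_samplePt, phase_samplePt,
    show Real.pi * ((n.1 : ℝ) + θ - (m.1 + θ)) = ((n.1 - m.1 : ℤ) : ℝ) * Real.pi by
      push_cast; ring, Real.sin_int_mul_pi, zero_div, Complex.ofReal_zero]

/-- Orthonormality is the sine formula at phases differing by integers; completeness is the totality
of the eigenvectors of T_θ. -/
theorem exists_sampleBasis (hF : IsCayleyFrame T φp φm e d A) {p θ : ℝ}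
    (hp : p ∈ extSpectrum T φp φm 0) (hθ : ExtDefined T φp φm θ) :
    ∃ b : HilbertBasis (SampleIdx T φp φm p θ) ℂ H,
      ∀ n, b n = modelVec T φp φm p (samplePt T φp φm p θ n) := by
  refine ⟨HilbertBasis.mkOfOrthogonalEqBot (hF.orthonormal_modelVec hp θ) ?_, fun n => by
    rw [HilbertBasis.coe_mkOfOrthogonalEqBot]⟩
  rw [Submodule.eq_bot_iff]
  intro s hs
  refine hF.eq_zero_of_forall_extSpectrum hθ fun x hx v hv => ?_
  obtain ⟨n, rfl⟩ := hF.exists_samplePt hp hx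
  have h1 : ⟪modelVec T φp φm p (samplePt T φp φm p θ n), s⟫_ℂ = 0 :=
    Submodule.inner_right_of_mem_orthogonal (Submodule.subset_span (mem_range_self n)) hs
  obtain ⟨c, rfl⟩ := (hF.mem_adjKer_iff hF.reg).1 hv
  rw [hF.modelVec_eq hp, inner_smul_left] at h1
  have h2 : modelCoeff A d (phase T φp φm p (samplePt T φp φm p θ n)) (samplePt T φp φm p θ n)
      ≠ 0 := fun h0 => by
    have h3 := hF.inner_modelVec_self hp (samplePt T φp φm p θ n)
    rw [hF.modelVec_eq hp, h0, zero_smul, inner_zero_left] at h3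
    exact zero_ne_one h3
  rw [inner_smul_left, (mul_eq_zero.1 h1).resolve_left (by simpa using h2), mul_zero]

theorem deriv_spectralFun (hF : IsCayleyFrame T φp φm e d A) {p θ : ℝ}
    (hp : p ∈ extSpectrum T φp φm 0) (n : SampleIdx T φp φm p θ) :
    deriv (spectralFun T φp φm p) (n.1 + θ) =
      (deriv (phase T φp φm p) (samplePt T φp φm p θ n))⁻¹ := by
  have h1 : HasStrictDerivAt (phase T φp φm p)
      (deriv (phase T φp φm p) (samplePt T φp φm p θ n)) (samplePt T φp φm p θ n) :=
    (hF.exists_phase hp).1.contDiffAt.hasStrictDerivAt (by simp)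
  -- Only the left-inverse property is needed: τ maps neighbourhoods onto neighbourhoods, so the
  -- arbitrary values of `spectralFun` off the range of τ do not matter.
  have h2 := h1.to_local_left_inverse (g := spectralFun T φp φm p) (hF.deriv_phase_pos hp _).ne'
    (.of_forall (Function.leftInverse_invFun (hF.strictMono_phase hp).injective))
  rw [phase_samplePt] at h2
  exact h2.hasDerivAt.deriv

/-- The expansion of the kernel in the basis belonging to `σ(T_0)`. -/
theorem hasSum_kernel (hF : IsCayleyFrame T φp φm e d A) {p : ℝ}
    (hp : p ∈ extSpectrum T φp φm 0) (h0 : ExtDefined T φp φm 0) {x y : ℝ}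
    (hx : x ∉ extSpectrum T φp φm 0) (hy : y ∉ extSpectrum T φp φm 0) :
    HasSum (fun n : SampleIdx T φp φm p 0 => ((
      (Real.sin (Real.pi * phase T φp φm p x) / (Real.pi * √(deriv (phase T φp φm p) x))) *
      (Real.sin (Real.pi * phase T φp φm p y) / (Real.pi * √(deriv (phase T φp φm p) y))) *
      (deriv (spectralFun T φp φm p) n.1 / ((x - samplePt T φp φm p 0 n) *
        (y - samplePt T φp φm p 0 n))) : ℝ) : ℂ)) (kerT T φp φm p x y) := by
  obtain ⟨b, hb⟩ := hF.exists_sampleBasis hp h0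
  have h1 := b.hasSum_inner_mul_inner (modelVec T φp φm p x) (modelVec T φp φm p y)
  have hne : ∀ z ∉ extSpectrum T φp φm 0, ∀ n, z ≠ samplePt T φp φm p 0 n := fun z hz n h =>
    hz (h ▸ hF.samplePt_mem_extSpectrum hp n)
  refine h1.congr_fun fun n => ?_
  have h2 := hF.deriv_spectralFun hp n
  rw [add_zero] at h2
  rw [hb, hF.inner_modelVec hp (hne x hx n), hF.inner_modelVec hp (hne y hy n).symm, h2,
    phase_samplePt, ← Complex.ofReal_mul, Complex.ofReal_inj]
  have hsin : ∀ t : ℝ, Real.sin (Real.pi * (t - (n.1 + 0))) =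
      (-1) ^ n.1 * Real.sin (Real.pi * t) := by
    intro t
    rw [← Real.sin_sub_int_mul_pi]
    congr 1
    ring
  have hsin' : ∀ t : ℝ, Real.sin (Real.pi * ((n.1 + 0) - t)) =
      -((-1) ^ n.1 * Real.sin (Real.pi * t)) := by
    intro t
    rw [← hsin, ← Real.sin_neg]
    congr 1
    ring
  rw [hsin, hsin']
  -- The signs from the two sines cancel, and the two factors √τ'(t_n) combine to 1/t'(n).
  have hs : ((-1 : ℝ) ^ n.1) * (-1) ^ n.1 = 1 := by
    rw [← mul_zpow]; simp
  have hxq := Real.sqrt_pos.2 (hF.deriv_phase_pos hp x)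
  have hyq := Real.sqrt_pos.2 (hF.deriv_phase_pos hp y)
  have hnq := Real.sqrt_pos.2 (hF.deriv_phase_pos hp (samplePt T φp φm p 0 n))
  have hx' := sub_ne_zero.2 (hne x hx n)
  have hy' := sub_ne_zero.2 (hne y hy n)
  have hy'' := sub_ne_zero.2 (hne y hy n).symm
  set s : ℝ := (-1) ^ n.1
  set a := samplePt T φp φm p 0 n
  have e1 : a - y = -(y - a) := by ring
  rw [e1]
  field_simp
  rw [Real.sq_sqrt (hF.deriv_phase_pos hp _).le,
    mul_div_cancel_right₀ _ (hF.deriv_phase_pos hp _).ne', sq, hs, mul_one]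

/-- The expansion has the form a(x) a(y) Σ. On the diagonal the kernel is 1, so |a| is `kerFactor`;
the sign of a is that of sin πτ, namely (-1)^⌊τ⌋. -/
theorem kerT_eq_series (hF : IsCayleyFrame T φp φm e d A) {p : ℝ}
    (hp : p ∈ extSpectrum T φp φm 0) (h0 : ExtDefined T φp φm 0) {x y : ℝ}
    (hx : x ∉ extSpectrum T φp φm 0) (hy : y ∉ extSpectrum T φp φm 0) :
    Summable (fun n : SampleIdx T φp φm p 0 =>
      deriv (spectralFun T φp φm p) (n.1 : ℝ) / (x - samplePt T φp φm p 0 n) ^ 2) ∧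
    kerT T φp φm p x y =
      ((kerFactor T φp φm p x * (-1) ^ ⌊phase T φp φm p x⌋ *
        (∑' n : SampleIdx T φp φm p 0, deriv (spectralFun T φp φm p) (n.1 : ℝ) /
          ((x - samplePt T φp φm p 0 n) * (y - samplePt T φp φm p 0 n))) *
        (-1) ^ ⌊phase T φp φm p y⌋ * kerFactor T φp φm p y : ℝ) : ℂ) := by
  set a : ℝ → ℝ := fun x =>
    Real.sin (Real.pi * phase T φp φm p x) / (Real.pi * √(deriv (phase T φp φm p) x)) with ha
  have hdiag : ∀ x ∉ extSpectrum T φp φm 0, a x ≠ 0 ∧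
      HasSum (fun n : SampleIdx T φp φm p 0 => deriv (spectralFun T φp φm p) (n.1 : ℝ) /
        (x - samplePt T φp φm p 0 n) ^ 2) (a x ^ 2)⁻¹ := by
    intro x hx
    have h1 := hF.hasSum_kernel hp h0 hx hx
    rw [kerT, hF.inner_modelVec_self hp, ← Complex.ofReal_one, Complex.hasSum_ofReal] at h1
    change HasSum (fun n => a x * a x * _) 1 at h1
    have hax : a x ≠ 0 := fun h => by
      simp only [h, mul_zero, zero_mul] at h1
      exact zero_ne_one (hasSum_zero.unique h1)
    refine ⟨hax, ?_⟩
    have h2 := h1.mul_left (a x ^ 2)⁻¹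
    rw [mul_one] at h2
    refine h2.congr_fun fun n => ?_
    field_simp
  have hsign : ∀ x ∉ extSpectrum T φp φm 0,
      a x = kerFactor T φp φm p x * (-1) ^ ⌊phase T φp φm p x⌋ := by
    intro x hx
    have hk : kerFactor T φp φm p x = |a x| := by
      rw [kerFactor, (hdiag x hx).2.tsum_eq, Real.rpow_neg (by positivity),
        ← Real.sqrt_eq_rpow, Real.sqrt_inv, inv_inv, Real.sqrt_sq_eq_abs]
    have hs : Real.sin (Real.pi * phase T φp φm p x) = (-1) ^ ⌊phase T φp φm p x⌋ *
        Real.sin (Real.pi * Int.fract (phase T φp φm p x)) := by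
      rw [← Real.sin_add_int_mul_pi]
      congr 1
      nth_rw 1 [← Int.floor_add_fract (phase T φp φm p x)]
      ring
    have hnn : 0 ≤ Real.sin (Real.pi * Int.fract (phase T φp φm p x)) := by
      apply Real.sin_nonneg_of_nonneg_of_le_pi
      · exact mul_nonneg Real.pi_pos.le (Int.fract_nonneg _)
      · exact mul_le_of_le_one_right Real.pi_pos.le (Int.fract_lt_one _).le
    have habs : |((-1 : ℝ)) ^ ⌊phase T φp φm p x⌋| = 1 := by
      rw [abs_zpow, abs_neg, abs_one, one_zpow]
    have hden : 0 ≤ Real.pi * √(deriv (phase T φp φm p) x) := by positivity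
    rw [hk, ha]
    simp only
    rw [hs, abs_div, abs_mul, habs, abs_of_nonneg hnn, abs_of_nonneg hden]
    ring
  refine ⟨(hdiag x hx).2.summable, ?_⟩
  have h1 := hF.hasSum_kernel hp h0 hx hy
  rw [← h1.tsum_eq, ← Complex.ofReal_tsum, tsum_mul_left, Complex.ofReal_inj]
  change a x * a y * _ = _
  rw [hsign x hx, hsign y hy]
  ring

end IsCayleyFrame

end Sampling

/-! ### Reproducing kernel Hilbert spaces as unitary images of H. -/

section KernelSpaces

variable {H : Type*} [NormedAddCommGroup H] [InnerProductSpace ℂ H]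

section RKHS

variable {𝒦 : Type*} [NormedAddCommGroup 𝒦] [InnerProductSpace ℂ 𝒦]
  [RKHS ℂ 𝒦 ℝ ℂ]

/-- A space of functions whose norm is the `L²` norm is isometrically embedded in `L²`. -/
theorem exists_isometry_Lp (ν : Measure ℝ) (hm : ∀ f : 𝒦, AEStronglyMeasurable (f : ℝ → ℂ) ν)
    (hn : ∀ f : 𝒦, ∫⁻ x, ‖f x‖ₑ ^ 2 ∂ν = ‖f‖ₑ ^ 2) :
    ∃ J : 𝒦 →ₗᵢ[ℂ] Lp ℂ 2 ν, ∀ f, J f =ᵐ[ν] (f : ℝ → ℂ) := by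
  have he : ∀ f : 𝒦, eLpNorm (f : ℝ → ℂ) 2 ν = ‖f‖ₑ := by
    intro f
    rw [eLpNorm_eq_lintegral_rpow_enorm_toReal two_ne_zero ENNReal.ofNat_ne_top]
    simp only [ENNReal.toReal_ofNat, ENNReal.rpow_ofNat]
    rw [hn, ← ENNReal.rpow_ofNat, ← ENNReal.rpow_mul]
    norm_num
  have hmem : ∀ f : 𝒦, MemLp (f : ℝ → ℂ) 2 ν := fun f => ⟨hm f, by rw [he]; exact enorm_lt_top⟩
  refine ⟨{ toFun := fun f => (hmem f).toLp _
            map_add' := fun f g => ?_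
            map_smul' := fun c f => ?_
            norm_map' := fun f => ?_ }, fun f => (hmem f).coeFn_toLp⟩
  · rw [← MemLp.toLp_add]
    exact MemLp.toLp_congr _ _ (.of_forall fun x => by rw [RKHS.coe_add])
  · rw [RingHom.id_apply, ← MemLp.toLp_const_smul]
    exact MemLp.toLp_congr _ _ (.of_forall fun x => by rw [RKHS.coe_smul])
  · change ‖(hmem f).toLp _‖ = ‖f‖
    rw [Lp.norm_toLp, he, toReal_enorm]

variable [CompleteSpace 𝒦]

theorem inner_pointEval (x : ℝ) (f : 𝒦) : ⟪pointEval 𝒦 x, f⟫_ℂ = f x := by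
  rw [pointEval, RKHS.kerFun_inner]
  simp

theorem dense_span_pointEval :
    (Submodule.span ℂ (range (pointEval 𝒦))).topologicalClosure = ⊤ := by
  rw [eq_top_iff, ← RKHS.kerFun_dense 𝒦]
  refine Submodule.topologicalClosure_mono (Submodule.span_le.2 ?_)
  rintro _ ⟨x, v, rfl⟩
  have : RKHS.kerFun 𝒦 x v = v • pointEval 𝒦 x := by
    rw [pointEval, ← map_smul, smul_eq_mul, mul_one]
  rw [this]
  exact Submodule.smul_mem _ _ (Submodule.subset_span (mem_range_self x))

end RKHS

theorem denseRange_linearCombination {ι F : Type*} [NormedAddCommGroup F]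
    [InnerProductSpace ℂ F] {v : ι → F}
    (hv : (Submodule.span ℂ (range v)).topologicalClosure = ⊤) :
    DenseRange (Finsupp.linearCombination ℂ v) := by
  rw [DenseRange, dense_iff_closure_eq, ← LinearMap.coe_range, Finsupp.range_linearCombination,
    ← Submodule.topologicalClosure_coe, hv, Submodule.top_coe]

/-- Two families with the same Gram matrix and dense span are unitarily equivalent. -/
theorem exists_unitary_of_gram [CompleteSpace H] {ι E : Type*} [NormedAddCommGroup E]
    [InnerProductSpace ℂ E] [CompleteSpace E] {ψ : ι → H} {χ : ι → E}
    (hψ : (Submodule.span ℂ (range ψ)).topologicalClosure = ⊤)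
    (hχ : (Submodule.span ℂ (range χ)).topologicalClosure = ⊤)
    (hg : ∀ i j, ⟪ψ i, ψ j⟫_ℂ = ⟪χ i, χ j⟫_ℂ) : ∃ U : H ≃ₗᵢ[ℂ] E, ∀ i, U (ψ i) = χ i := by
  have hnorm : ∀ a, ‖Finsupp.linearCombination ℂ χ (LinearEquiv.refl ℂ (ι →₀ ℂ) a)‖ =
      ‖Finsupp.linearCombination ℂ ψ a‖ := by
    intro a
    rw [LinearEquiv.refl_apply, norm_eq_sqrt_re_inner (𝕜 := ℂ), norm_eq_sqrt_re_inner (𝕜 := ℂ)]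
    simp only [Finsupp.linearCombination_apply, Finsupp.sum, sum_inner, inner_sum,
      inner_smul_left, inner_smul_right, hg]
  refine ⟨(LinearEquiv.refl ℂ (ι →₀ ℂ)).extendOfIsometry (Finsupp.linearCombination ℂ ψ)
    (Finsupp.linearCombination ℂ χ) (denseRange_linearCombination hψ)
    (denseRange_linearCombination hχ) hnorm, fun i => ?_⟩
  have h := LinearEquiv.extendOfIsometry_eq (LinearEquiv.refl ℂ (ι →₀ ℂ))
    (Finsupp.linearCombination ℂ ψ) (Finsupp.linearCombination ℂ χ) (denseRange_linearCombination hψ)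
    (denseRange_linearCombination hχ) hnorm
    (Finsupp.single i 1)
  simpa using h

theorem pointEval_apply (k : ℝ → ℝ → ℂ) [Fact (toKernel k).PosSemidef] (x y : ℝ) :
    pointEval (RKHS.OfKernel (toKernel k)) y x = k x y := by
  rw [pointEval, RKHS.kerFun_apply, RKHS.OfKernel.kernel_ofKernel]
  simp [toKernel]

/-- The Hilbert space `H` is represented as the reproducing kernel Hilbert space of the Gram
kernel of a total family. -/
theorem exists_unitary_ofKernel [CompleteSpace H] {ψ : ℝ → H} {k : ℝ → ℝ → ℂ}
    [Fact (toKernel k).PosSemidef] (hk : ∀ x y, k x y = ⟪ψ x, ψ y⟫_ℂ)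
    (hψ : (Submodule.span ℂ (range ψ)).topologicalClosure = ⊤) :
    ∃ U : H ≃ₗᵢ[ℂ] RKHS.OfKernel (toKernel k),
      (∀ x, U (ψ x) = pointEval _ x) ∧ ∀ h x, U h x = ⟪ψ x, h⟫_ℂ := by
  obtain ⟨U, hU⟩ := exists_unitary_of_gram hψ
    (dense_span_pointEval (𝒦 := RKHS.OfKernel (toKernel k))) (fun x y => by
      rw [inner_pointEval, pointEval_apply, hk])
  exact ⟨U, hU, fun h x => by rw [← inner_pointEval, ← hU, U.inner_map_map]⟩

end KernelSpaces

/-! ### Parseval's identity integrated over the parameter θ. -/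

section Isometry

theorem paramExt_add_intCast (μ : ℝ → ℝ) (s : ℝ) (n : ℤ) :
    paramExt μ (s + n) = paramExt μ s + n := by
  rw [paramExt, paramExt, Int.floor_add_intCast, Int.fract_add_intCast]
  push_cast
  ring

theorem deriv_paramExt_add_intCast (μ : ℝ → ℝ) (s : ℝ) (n : ℤ) :
    deriv (paramExt μ) (s + n) = deriv (paramExt μ) s := by
  rw [← deriv_comp_add_const]
  simp only [paramExt_add_intCast, deriv_add_const]

theorem lintegral_deriv_paramExt {μ : ℝ → ℝ} (hμ : IsSmoothParam μ) :
    ∫⁻ s in Ico (0 : ℝ) 1, ENNReal.ofReal (deriv (paramExt μ) s) = 1 := by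
  have hc : Continuous (deriv (paramExt μ)) := hμ.ext_contDiff.continuous_deriv (by simp)
  have h1 : ∫ s in (0 : ℝ)..1, deriv (paramExt μ) s = 1 := by
    rw [intervalIntegral.integral_deriv_eq_sub
      (fun x _ => (hμ.ext_contDiff.differentiable (by simp)) x) (hc.intervalIntegrable _ _)]
    have := paramExt_add_intCast μ 0 1
    rw [Int.cast_one, zero_add] at this
    rw [this, add_sub_cancel_left]
  rw [← Measure.restrict_congr_set Ioo_ae_eq_Ico, Measure.restrict_congr_set Ioo_ae_eq_Ioc,
    ← ofReal_integral_eq_lintegral_ofReal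
      ((intervalIntegrable_iff_integrableOn_Ioc_of_le zero_le_one).1 (hc.intervalIntegrable _ _))
      (.of_forall fun s => (hμ.deriv_pos s).le),
    ← intervalIntegral.integral_of_le zero_le_one, h1, ENNReal.ofReal_one]

/-- An integral over the line, as the integral over `[0, 1)` of the sum over all integer
translates. -/
theorem lintegral_eq_lintegral_tsum_translates {G : ℝ → ENNReal} (hG : Measurable G) :
    ∫⁻ s, G s = ∫⁻ s in Ico (0 : ℝ) 1, ∑' n : ℤ, G (n + s) := by
  have h1 : ∀ n : ℤ, ∫⁻ s in Ico (n : ℝ) (n + 1), G s = ∫⁻ s in Ico (0 : ℝ) 1, G (n + s) := by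
    intro n
    have h2 := (measurePreserving_add_left (volume : Measure ℝ) (n : ℝ)).setLIntegral_comp_preimage
      (measurableSet_Ico (a := (n : ℝ)) (b := n + 1)) hG
    have h3 : (fun s : ℝ => (n : ℝ) + s) ⁻¹' Ico (n : ℝ) (n + 1) = Ico 0 1 := by
      ext s; simp
    rw [← h2, h3]
  have h2 : ∀ n : ℤ, Measurable fun s => G ((n : ℝ) + s) := fun n =>
    hG.comp (measurable_const_add _)
  rw [lintegral_tsum fun n => (h2 n).aemeasurable]
  simp_rw [← h1]
  rw [← lintegral_iUnion (fun n => measurableSet_Ico) (pairwise_disjoint_Ico_intCast ℝ),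
    iUnion_Ico_intCast, setLIntegral_univ]

variable {H : Type*} [NormedAddCommGroup H] [InnerProductSpace ℂ H]

theorem _root_.HilbertBasis.tsum_enorm_inner_sq {ι : Type*} (b : HilbertBasis ι ℂ H) (h : H) :
    ∑' i, ‖⟪b i, h⟫_ℂ‖ₑ ^ 2 = ‖h‖ₑ ^ 2 := by
  have h1 := b.hasSum_inner_mul_inner h h
  have h2 : HasSum (fun i => ‖⟪b i, h⟫_ℂ‖ ^ 2) (‖h‖ ^ 2) := by
    rw [← Complex.hasSum_ofReal]
    rw [inner_self_eq_norm_sq_to_K] at h1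
    push_cast
    refine h1.congr_fun fun i => ?_
    rw [← inner_conj_symm h (b i), RCLike.conj_mul]
    rfl
  have h3 := ENNReal.ofReal_tsum_of_nonneg (fun i => sq_nonneg ‖⟪b i, h⟫_ℂ‖) h2.summable
  rw [h2.tsum_eq] at h3
  simp only [ENNReal.ofReal_pow (norm_nonneg _), ofReal_norm] at h3
  exact h3.symm

theorem phaseExp_injOn : InjOn phaseExp (Ico 0 1) := by
  intro a ha b hb hab
  rw [phaseExp, phaseExp, Complex.exp_eq_exp_iff_exists_int] at hab
  obtain ⟨n, hn⟩ := hab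
  have hpi : (2 * Real.pi * Complex.I : ℂ) ≠ 0 := by
    simp [Real.pi_ne_zero]
  have h1 : (a : ℂ) = b + n := by
    apply mul_left_cancel₀ hpi
    rw [hn]; ring
  have h2 : a = b + n := by exact_mod_cast h1
  have h3 : (-1 : ℝ) < n := by linarith [ha.1, hb.2]
  have h4 : (n : ℝ) < 1 := by linarith [ha.2, hb.1]
  have h5 : n = 0 := by
    have h6 : -1 < n := by exact_mod_cast h3
    have h7 : n < 1 := by exact_mod_cast h4
    omega
  rw [h2, h5, Int.cast_zero, add_zero]

namespace IsCayleyFrame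

variable {T : H →ₗ.[ℂ] H} {φp φm e d : H} {A : H →L[ℂ] H}

theorem countable_not_extDefined (hF : IsCayleyFrame T φp φm e d A) :
    {θ ∈ Ico (0 : ℝ) 1 | ¬ ExtDefined T φp φm θ}.Countable :=
  Set.Subsingleton.countable fun _ ha _ hb =>
    phaseExp_injOn ha.1 hb.1 (hF.phaseExp_eq_of_not_extDefined ha.2 hb.2)

/-- The parameters 0 and 1/2 cannot both be exceptional. -/
theorem exists_extDefined (hF : IsCayleyFrame T φp φm e d A) :
    ∃ θ ∈ Ico (0 : ℝ) 1, ExtDefined T φp φm θ := by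
  by_contra! h
  have h1 := phaseExp_injOn (x₁ := 0) (x₂ := 1 / 2) (by norm_num) (by norm_num)
    (hF.phaseExp_eq_of_not_extDefined (h 0 (by norm_num)) (h (1 / 2) (by norm_num)))
  norm_num at h1

variable [CompleteSpace H]

theorem density_eq (hF : IsCayleyFrame T φp φm e d A) {p : ℝ}
    (hp : p ∈ extSpectrum T φp φm 0) {μ : ℝ → ℝ} (hμ : IsSmoothParam μ) (x : ℝ) :
    density T φp φm p μ x =
      deriv (paramExt μ) (phase T φp φm p x) * deriv (phase T φp φm p) x :=
  deriv_comp x ((hμ.ext_contDiff.differentiable (by simp)) _)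
    (((hF.exists_phase hp).1.differentiable (by simp)) x)

theorem density_pos (hF : IsCayleyFrame T φp φm e d A) {p : ℝ}
    (hp : p ∈ extSpectrum T φp φm 0) {μ : ℝ → ℝ} (hμ : IsSmoothParam μ) (x : ℝ) :
    0 < density T φp φm p μ x := by
  rw [hF.density_eq hp hμ]
  exact mul_pos (hμ.deriv_pos _) (hF.deriv_phase_pos hp x)

theorem continuous_density (hF : IsCayleyFrame T φp φm e d A) {p : ℝ}
    (hp : p ∈ extSpectrum T φp φm 0) {μ : ℝ → ℝ} (hμ : IsSmoothParam μ) :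
    Continuous (density T φp φm p μ) :=
  (hμ.ext_contDiff.comp (hF.exists_phase hp).1).continuous_deriv (by simp)

/-- Parseval's identity, integrated over the parameter `θ`. -/
theorem lintegral_density (hF : IsCayleyFrame T φp φm e d A) {p : ℝ}
    (hp : p ∈ extSpectrum T φp φm 0) {μ : ℝ → ℝ} (hμ : IsSmoothParam μ) (h : H) :
    ∫⁻ x, ENNReal.ofReal (density T φp φm p μ x) * ‖⟪modelVec T φp φm p x, h⟫_ℂ‖ₑ ^ 2 =
      ‖h‖ₑ ^ 2 := by
  set τ := phase T φp φm p with hτ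
  have hinj : Function.Injective τ := (hF.strictMono_phase hp).injective
  have hsmooth : ContDiff ℝ ∞ τ := (hF.exists_phase hp).1
  have hm : Continuous (deriv (paramExt μ)) := hμ.ext_contDiff.continuous_deriv (by simp)
  have hφ := hF.continuous_modelVec hp
  have hemb : MeasurableEmbedding τ := hsmooth.continuous.measurableEmbedding hinj
  set f : ℝ → ENNReal := fun x =>
    ENNReal.ofReal (deriv (paramExt μ) (τ x)) * ‖⟪modelVec T φp φm p x, h⟫_ℂ‖ₑ ^ 2 with hf
  have hfm : Measurable f := by
    refine (ENNReal.measurable_ofReal.comp (hm.comp hsmooth.continuous).measurable).mul ?_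
    exact (hφ.inner continuous_const).enorm.measurable.pow_const 2
  -- f transported to the phase variable s = τ(x), and zero off the range of τ, which need not be
  -- all of ℝ.
  set G : ℝ → ENNReal := Function.extend τ f 0 with hG
  have hGm : Measurable G := hemb.measurable_extend hfm measurable_zero
  have hGτ : ∀ x, G (τ x) = f x := fun x => hinj.extend_apply f 0 x
  have h1 : ∫⁻ x, ENNReal.ofReal (density T φp φm p μ x) *
      ‖⟪modelVec T φp φm p x, h⟫_ℂ‖ₑ ^ 2 = ∫⁻ s in range τ, G s := by
    have h2 := lintegral_image_eq_lintegral_abs_deriv_mul (s := univ) (f := τ) (f' := deriv τ)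
      MeasurableSet.univ
      (fun x _ => ((hsmooth.differentiable (by simp)) x).hasDerivAt.hasDerivWithinAt)
      hinj.injOn G
    rw [image_univ, setLIntegral_univ] at h2
    rw [h2]
    refine lintegral_congr fun x => ?_
    rw [hGτ, hf, hF.density_eq hp hμ, abs_of_pos (hF.deriv_phase_pos hp x),
      ENNReal.ofReal_mul (hμ.deriv_pos _).le]
    ring
  have h3 : ∫⁻ s in range τ, G s = ∫⁻ s, G s := by
    refine setLIntegral_eq_of_support_subset ?_
    intro s hs
    by_contra hs'
    exact hs (by rw [hG, Function.extend_apply' _ _ _ hs']; rfl)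
  rw [h1, h3, lintegral_eq_lintegral_tsum_translates hGm]
  -- For almost every θ the sum over n runs over the basis at the points t_n(θ). The weight μ' has
  -- period 1, so it factors out and Parseval gives ‖h‖².
  have h4 : ∫⁻ s in Ico (0 : ℝ) 1, ∑' n : ℤ, G (n + s) =
      ∫⁻ s in Ico (0 : ℝ) 1, ENNReal.ofReal (deriv (paramExt μ) s) * ‖h‖ₑ ^ 2 := by
    refine setLIntegral_congr_fun_ae measurableSet_Ico ?_
    have h5 := hF.countable_not_extDefined.ae_notMem (volume : Measure ℝ)
    filter_upwards [h5] with θ hθ hθ01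
    have hdef : ExtDefined T φp φm θ := by
      by_contra hn
      exact hθ ⟨hθ01, hn⟩
    obtain ⟨b, hb⟩ := hF.exists_sampleBasis hp hdef
    rw [← b.tsum_enorm_inner_sq h, ← ENNReal.tsum_mul_left]
    have h6 : (fun n : ℤ => G (n + θ)) =
        {n : ℤ | (n : ℝ) + θ ∈ range τ}.indicator fun n => G (n + θ) := by
      symm
      rw [indicator_eq_self]
      intro n hn
      by_contra hn'
      exact hn (Function.extend_apply' _ _ _ hn')
    rw [h6, ← tsum_subtype]
    refine tsum_congr fun n : SampleIdx T φp φm p θ => ?_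
    rw [hb, ← phase_samplePt n, ← hτ, hGτ, hf]
    simp only
    rw [hτ, phase_samplePt, add_comm, deriv_paramExt_add_intCast]
  rw [h4, lintegral_mul_const _ hm.measurable.ennreal_ofReal,
    lintegral_deriv_paramExt hμ, one_mul]

end IsCayleyFrame

end Isometry

/-! ### Transport of bases and operators to the function spaces. -/

section Main

variable {H : Type*} [NormedAddCommGroup H] [InnerProductSpace ℂ H]

theorem unitaryConj_apply {𝒦 : Type*} [NormedAddCommGroup 𝒦] [InnerProductSpace ℂ 𝒦]
    (U : H ≃ₗᵢ[ℂ] 𝒦) (B : H →ₗ.[ℂ] H) (f : (unitaryConj U B).domain) :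
    unitaryConj U B f = U (B ⟨U.symm f, f.2⟩) := rfl

theorem unitaryConj_eq_smul {𝒦 : Type*} [NormedAddCommGroup 𝒦] [InnerProductSpace ℂ 𝒦]
    (U : H ≃ₗᵢ[ℂ] 𝒦) (B : H →ₗ.[ℂ] H) {v : H} {f : 𝒦} {z : ℂ} (hv : U v = f)
    (hB : ∃ h : v ∈ B.domain, B ⟨v, h⟩ = z • v) :
    ∃ h : f ∈ (unitaryConj U B).domain, unitaryConj U B ⟨f, h⟩ = z • f := by
  obtain ⟨h, hz⟩ := hB
  subst hv
  have hsymm : U.symm (U v) = v := U.symm_apply_apply v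
  have hdom : U v ∈ (unitaryConj U B).domain := by
    change U.symm (U v) ∈ B.domain
    rwa [hsymm]
  refine ⟨hdom, ?_⟩
  rw [unitaryConj_apply, ← map_smul, ← hz]
  congr 2
  exact Subtype.ext hsymm

namespace IsCayleyFrame

variable [CompleteSpace H] {T : H →ₗ.[ℂ] H} {φp φm e d : H} {A : H →L[ℂ] H}

/-- A single admissible θ suffices, since its sampling vectors already form a basis. The weight w
lets 1 and √(μ∘τ)' be treated together. -/
theorem modelVec_total (hF : IsCayleyFrame T φp φm e d A) {p : ℝ}
    (hp : p ∈ extSpectrum T φp φm 0) {w : ℝ → ℝ} (hw : ∀ x, 0 < w x) :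
    (Submodule.span ℂ (range fun x => (w x : ℂ) • modelVec T φp φm p x)).topologicalClosure =
      ⊤ := by
  rw [Submodule.topologicalClosure_eq_top_iff, Submodule.eq_bot_iff]
  intro s hs
  obtain ⟨θ, -, hθ⟩ := hF.exists_extDefined
  obtain ⟨b, hb⟩ := hF.exists_sampleBasis hp hθ
  have h1 : ∀ n, ⟪b n, s⟫_ℂ = 0 := by
    intro n
    have h2 : ⟪(w (samplePt T φp φm p θ n) : ℂ) • modelVec T φp φm p (samplePt T φp φm p θ n),
      s⟫_ℂ = 0 := Submodule.inner_right_of_mem_orthogonal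
        (Submodule.subset_span (mem_range.2 ⟨samplePt T φp φm p θ n, rfl⟩)) hs
    rw [inner_smul_left, Complex.conj_ofReal, ← hb] at h2
    exact (mul_eq_zero.1 h2).resolve_left (by exact_mod_cast (hw _).ne')
  have h3 := b.tsum_enorm_inner_sq s
  simpa [h1] using h3.symm

variable {𝒦 : Type*} [NormedAddCommGroup 𝒦] [InnerProductSpace ℂ 𝒦]
  [RKHS ℂ 𝒦 ℝ ℂ]

/-- As φ_x ∈ ker(T* - x), ⟨φ_x, Tg⟩ = x⟨φ_x, g⟩. -/
theorem unitaryConj_mul (hF : IsCayleyFrame T φp φm e d A) {p : ℝ}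
    (hp : p ∈ extSpectrum T φp φm 0) {w : ℝ → ℝ} (U : H ≃ₗᵢ[ℂ] 𝒦)
    (hU : ∀ h x, U h x = (w x : ℂ) * ⟪modelVec T φp φm p x, h⟫_ℂ)
    (f : (unitaryConj U T).domain) (x : ℝ) :
    unitaryConj U T f x = (x : ℂ) * (f : 𝒦) x := by
  set g : T.domain := ⟨U.symm f, f.2⟩
  have hfg : (f : 𝒦) = U g := (U.apply_symm_apply _).symm
  have h1 := mem_adjKer.1 (hF.isModelVec_modelVec hp x).1 g
  rw [Complex.conj_ofReal, inner_eq_zero_symm, inner_sub_right, inner_smul_right,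
    sub_eq_zero] at h1
  change U (T g) x = _
  rw [hfg, hU, hU, h1]
  ring

variable [CompleteSpace 𝒦]

theorem exists_pointEval_basis (hF : IsCayleyFrame T φp φm e d A) {p θ : ℝ}
    (hp : p ∈ extSpectrum T φp φm 0) (hθ : ExtDefined T φp φm θ) {w : ℝ → ℝ}
    (hw : ∀ x, 0 < w x) (U : H ≃ₗᵢ[ℂ] 𝒦)
    (hU : ∀ x, U ((w x : ℂ) • modelVec T φp φm p x) = pointEval 𝒦 x) :
    ∃ b : HilbertBasis (SampleIdx T φp φm p θ) ℂ 𝒦, ∀ n, b n =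
      (w (samplePt T φp φm p θ n) : ℂ)⁻¹ • pointEval 𝒦 (samplePt T φp φm p θ n) := by
  obtain ⟨b, hb⟩ := hF.exists_sampleBasis hp hθ
  refine ⟨HilbertBasis.ofRepr (U.symm.trans b.repr), fun n => ?_⟩
  have h1 : (HilbertBasis.ofRepr (U.symm.trans b.repr)) n = U (b n) := by
    classical
    rw [← HilbertBasis.repr_symm_single, ← HilbertBasis.repr_symm_single]
    rfl
  have h2 : (w (samplePt T φp φm p θ n) : ℂ) ≠ 0 := by exact_mod_cast (hw _).ne'
  rw [h1, hb, ← hU, map_smul, inv_smul_smul₀ h2]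

theorem unitaryConj_selfAdjointExt (hF : IsCayleyFrame T φp φm e d A) {p θ : ℝ}
    (hp : p ∈ extSpectrum T φp φm 0) (hθ : ExtDefined T φp φm θ) {w : ℝ → ℝ}
    (U : H ≃ₗᵢ[ℂ] 𝒦) (hU : ∀ x, U ((w x : ℂ) • modelVec T φp φm p x) = pointEval 𝒦 x)
    (n : SampleIdx T φp φm p θ) :
    ∃ h : pointEval 𝒦 (samplePt T φp φm p θ n) ∈
        (unitaryConj U (selfAdjointExt T φp φm θ)).domain,
      unitaryConj U (selfAdjointExt T φp φm θ) ⟨_, h⟩ =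
        (samplePt T φp φm p θ n : ℂ) • pointEval 𝒦 (samplePt T φp φm p θ n) :=
  unitaryConj_eq_smul U _ (hU _) (hF.exists_selfAdjointExt_eq hθ
    (hF.samplePt_mem_extSpectrum hp n)
    (Submodule.smul_mem _ _ (hF.isModelVec_modelVec hp _).1))

end IsCayleyFrame

/-- Expand ⟨K_x, f⟩ in the basis; the normalisation w⁻¹ enters twice, hence the square. -/
theorem hasSum_of_basis {𝒦 : Type*} [NormedAddCommGroup 𝒦] [InnerProductSpace ℂ 𝒦]
    [CompleteSpace 𝒦] [RKHS ℂ 𝒦 ℝ ℂ] {ι : Type*} (b : HilbertBasis ι ℂ 𝒦) {w t : ι → ℝ}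
    (hb : ∀ n, b n = (w n : ℂ)⁻¹ • pointEval 𝒦 (t n)) (f : 𝒦) (x : ℝ) :
    HasSum (fun n => f (t n) * (pointEval 𝒦 (t n) x / (w n : ℂ) ^ 2)) (f x) := by
  have h1 := b.hasSum_inner_mul_inner (pointEval 𝒦 x) f
  rw [inner_pointEval] at h1
  refine h1.congr_fun fun n => ?_
  rw [hb, inner_smul_left, inner_smul_right, inner_pointEval, inner_pointEval, map_inv₀,
    Complex.conj_ofReal]
  ring

end Main

end

end LocalBandlimit

/-! ### Assembly of the theorem. -/

theorem mainTheorem4 {H : Type*} [NormedAddCommGroup H] [InnerProductSpace ℂ H] [CompleteSpace H]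
    [TopologicalSpace.SeparableSpace H] (T : H →ₗ.[ℂ] H)
    (hT : IsRegularSimpleSymmetric T) (φp φm : H)
    (hφ : IsDeficiencyPair T φp φm)
    -- the eigenvalue of `T_0` that carries the label `0`
    (p : ℝ) (hp : p ∈ extSpectrum T φp φm 0)
    (μ : ℝ → ℝ) (hμ : IsSmoothParam μ) :
    -- the phase function, the spectral function and the vectors `φ_x` are what they should be
    (StrictMono (phase T φp φm p) ∧
      ContDiff ℝ ∞ (phase T φp φm p) ∧
      (∀ x, 0 < deriv (phase T φp φm p) x) ∧
      (∀ θ ∈ Ico (0 : ℝ) 1, extSpectrum T φp φm θ =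
        {x | ∃ n : ℤ, phase T φp φm p x = (n : ℝ) + θ}) ∧
      ∀ x v, IsModelVec T φp φm p x v ↔ v = modelVec T φp φm p x) ∧
    -- the kernel `K^T` is given by the usual series in the points of `σ(T_0)`
    ((Dense (T.domain : Set H) ∨ ExtDefined T φp φm 0) →
      ∀ x ∉ extSpectrum T φp φm 0, ∀ y ∉ extSpectrum T φp φm 0,
        Summable (fun n : SampleIdx T φp φm p 0 =>
          deriv (spectralFun T φp φm p) (n.1 : ℝ) /
            (x - samplePt T φp φm p 0 n) ^ 2) ∧
        kerT T φp φm p x y =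
          ((kerFactor T φp φm p x *
            (-1) ^ ⌊phase T φp φm p x⌋ *
            (∑' n : SampleIdx T φp φm p 0,
              deriv (spectralFun T φp φm p) (n.1 : ℝ) /
                ((x - samplePt T φp φm p 0 n) *
                  (y - samplePt T φp φm p 0 n))) *
            (-1) ^ ⌊phase T φp φm p y⌋ *
            kerFactor T φp φm p y : ℝ) : ℂ)) ∧
    -- `𝒦(T)` is an isometrically embedded subspace of `L²(ℝ, (μ ∘ τ)' dt)`
    (∃ J : SpaceT T φp φm p →ₗᵢ[ℂ]
        Lp ℂ 2 (weightedMeasure T φp φm p μ),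
      ∀ f, J f =ᵐ[weightedMeasure T φp φm p μ] (f : ℝ → ℂ)) ∧
    -- `𝒦(T;μ)` is an isometrically embedded subspace of `L²(ℝ)`
    (∃ J : SpaceTμ T φp φm p μ →ₗᵢ[ℂ] Lp ℂ 2 (volume : Measure ℝ),
      ∀ f, J f =ᵐ[volume] (f : ℝ → ℂ)) ∧
    -- the space `𝒦(T)`
    (∃ U : H ≃ₗᵢ[ℂ] SpaceT T φp φm p,
      (∀ h x, U h x = ⟪modelVec T φp φm p x, h⟫_ℂ) ∧
      (∀ θ ∈ Ico (0 : ℝ) 1,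
        (Dense (T.domain : Set H) ∨ ExtDefined T φp φm θ) →
        (∃ b : HilbertBasis (SampleIdx T φp φm p θ) ℂ
            (SpaceT T φp φm p),
          ∀ n, b n = pointEval (SpaceT T φp φm p)
            (samplePt T φp φm p θ n)) ∧
        (∀ n : SampleIdx T φp φm p θ,
          ∃ h : pointEval (SpaceT T φp φm p)
              (samplePt T φp φm p θ n) ∈
              (unitaryConj U (selfAdjointExt T φp φm θ)).domain,
            unitaryConj U (selfAdjointExt T φp φm θ) ⟨_, h⟩ =
              (samplePt T φp φm p θ n : ℂ) •
                pointEval (SpaceT T φp φm p)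
                  (samplePt T φp φm p θ n)) ∧
        ∀ (f : SpaceT T φp φm p) (x : ℝ),
          HasSum (fun n : SampleIdx T φp φm p θ =>
            f (samplePt T φp φm p θ n) *
              kerT T φp φm p x (samplePt T φp φm p θ n)) (f x)) ∧
      ∀ (f : (unitaryConj U T).domain) (x : ℝ),
        unitaryConj U T f x =
          (x : ℂ) * (f : SpaceT T φp φm p) x) ∧
    -- the space `𝒦(T;μ)`
    (∃ U : H ≃ₗᵢ[ℂ] SpaceTμ T φp φm p μ,
      (∀ h x, U h x = (Real.sqrt (density T φp φm p μ x) : ℂ) *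
        ⟪modelVec T φp φm p x, h⟫_ℂ) ∧
      (∀ θ ∈ Ico (0 : ℝ) 1,
        (Dense (T.domain : Set H) ∨ ExtDefined T φp φm θ) →
        (∀ n : SampleIdx T φp φm p θ,
          0 < density T φp φm p μ (samplePt T φp φm p θ n) ∧
          kerTμ T φp φm p μ (samplePt T φp φm p θ n)
              (samplePt T φp φm p θ n) =
            (density T φp φm p μ (samplePt T φp φm p θ n) : ℂ)) ∧
        (∃ b : HilbertBasis (SampleIdx T φp φm p θ) ℂ
            (SpaceTμ T φp φm p μ),
          ∀ n, b n =
            (Real.sqrt (density T φp φm p μ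
              (samplePt T φp φm p θ n)) : ℂ)⁻¹ •
            pointEval (SpaceTμ T φp φm p μ)
              (samplePt T φp φm p θ n)) ∧
        (∀ n : SampleIdx T φp φm p θ,
          ∃ h : pointEval (SpaceTμ T φp φm p μ)
              (samplePt T φp φm p θ n) ∈
              (unitaryConj U (selfAdjointExt T φp φm θ)).domain,
            unitaryConj U (selfAdjointExt T φp φm θ) ⟨_, h⟩ =
              (samplePt T φp φm p θ n : ℂ) •
                pointEval (SpaceTμ T φp φm p μ)
                  (samplePt T φp φm p θ n)) ∧
        ∀ (f : SpaceTμ T φp φm p μ) (x : ℝ),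
          HasSum (fun n : SampleIdx T φp φm p θ =>
            f (samplePt T φp φm p θ n) *
              (kerTμ T φp φm p μ x (samplePt T φp φm p θ n) /
                kerTμ T φp φm p μ (samplePt T φp φm p θ n)
                  (samplePt T φp φm p θ n))) (f x)) ∧
      ∀ (f : (unitaryConj U T).domain) (x : ℝ),
        unitaryConj U T f x =
          (x : ℂ) * (f : SpaceTμ T φp φm p μ) x) := by
  obtain ⟨e, d, A, hF⟩ := exists_isCayleyFrame hT hφ
  have hext : ∀ θ, (Dense (T.domain : Set H) ∨ ExtDefined T φp φm θ) → ExtDefined T φp φm θ :=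
    fun θ h => h.elim (fun h => hF.extDefined_of_dense h θ) id
  have hdens := hF.density_pos hp hμ
  have hsqrt : ∀ x, 0 < Real.sqrt (density T φp φm p μ x) := fun x => Real.sqrt_pos.2 (hdens x)
  have hsq : ∀ x, (Real.sqrt (density T φp φm p μ x) : ℂ) ^ 2 = (density T φp φm p μ x : ℂ) :=
    fun x => by exact_mod_cast Real.sq_sqrt (hdens x).le
  have hdiag : ∀ x, kerTμ T φp φm p μ x x = (density T φp φm p μ x : ℂ) := fun x => by
    rw [kerTμ, kerT, hF.inner_modelVec_self hp, ← hsq]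
    ring
  -- The scalar 1 is kept explicit so that 𝒦(T) is the case w = 1 of the weighted lemmas.
  obtain ⟨U, hU, hU'⟩ := exists_unitary_ofKernel (k := kerT T φp φm p)
    (ψ := fun x => ((1 : ℝ) : ℂ) • modelVec T φp φm p x)
    (fun x y => by simp [kerT]) (hF.modelVec_total hp (w := fun _ => 1) fun _ => one_pos)
  have hU1 : ∀ h x, U h x = ((1 : ℝ) : ℂ) * ⟪modelVec T φp φm p x, h⟫_ℂ := fun h x => by
    rw [hU', inner_smul_left, Complex.conj_ofReal]
  have hU1' : ∀ h x, U h x = ⟪modelVec T φp φm p x, h⟫_ℂ := fun h x => by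
    rw [hU1, Complex.ofReal_one, one_mul]
  obtain ⟨W, hW, hW'⟩ := exists_unitary_ofKernel (k := kerTμ T φp φm p μ)
    (ψ := fun x => (Real.sqrt (density T φp φm p μ x) : ℂ) • modelVec T φp φm p x)
    (fun x y => by rw [kerTμ_eq_gram]) (hF.modelVec_total hp hsqrt)
  have hW1 : ∀ h x, W h x =
      (Real.sqrt (density T φp φm p μ x) : ℂ) * ⟪modelVec T φp φm p x, h⟫_ℂ := fun h x => by
    rw [hW', inner_smul_left, Complex.conj_ofReal]
  have hinner : ∀ h : H, Continuous fun x => ⟪modelVec T φp φm p x, h⟫_ℂ := fun h =>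
    (hF.continuous_modelVec hp).inner continuous_const
  have hUc : ∀ f : SpaceT T φp φm p, Continuous (f : ℝ → ℂ) := fun f => by
    obtain ⟨h, rfl⟩ := U.surjective f
    exact (hinner h).congr fun x => (hU1' h x).symm
  have hWc : ∀ f : SpaceTμ T φp φm p μ, Continuous (f : ℝ → ℂ) := fun f => by
    obtain ⟨h, rfl⟩ := W.surjective f
    exact ((Complex.continuous_ofReal.comp (Real.continuous_sqrt.comp
      (hF.continuous_density hp hμ))).mul (hinner h)).congr fun x => (hW1 h x).symm
  refine ⟨⟨hF.strictMono_phase hp, (hF.exists_phase hp).1, hF.deriv_phase_pos hp,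
      fun θ _ => Set.ext fun x => hF.mem_extSpectrum_iff hp, fun x v => hF.isModelVec_iff_eq hp⟩,
    fun h0 x hx y hy => hF.kerT_eq_series hp (hext 0 h0) hx hy, ?_, ?_,
    ⟨U, hU1', fun θ _ hθ => ?_, hF.unitaryConj_mul hp U hU1⟩,
    ⟨W, hW1, fun θ _ hθ => ?_, hF.unitaryConj_mul hp W hW1⟩⟩
  · refine exists_isometry_Lp _ (fun f => (hUc f).aestronglyMeasurable) fun f => ?_
    obtain ⟨h, rfl⟩ := U.surjective f
    rw [weightedMeasure, lintegral_withDensity_eq_lintegral_mul _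
      (hF.continuous_density hp hμ).measurable.ennreal_ofReal
      ((hUc _).enorm.measurable.pow_const 2), U.enorm_map, ← hF.lintegral_density hp hμ h]
    exact lintegral_congr fun x => by rw [Pi.mul_apply, hU1']
  · refine exists_isometry_Lp _ (fun f => (hWc f).aestronglyMeasurable) fun f => ?_
    obtain ⟨h, rfl⟩ := W.surjective f
    rw [W.enorm_map, ← hF.lintegral_density hp hμ h]
    refine lintegral_congr fun x => ?_
    rw [hW1, enorm_mul, mul_pow, ← enorm_pow, hsq, ← ofReal_norm, Complex.norm_real,
      Real.norm_of_nonneg (hdens x).le]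
  · obtain ⟨b, hb⟩ := hF.exists_pointEval_basis hp (hext θ hθ) (w := fun _ => 1)
      (fun _ => one_pos) U hU
    refine ⟨⟨b, fun n => by rw [hb, Complex.ofReal_one, inv_one, one_smul]⟩,
      hF.unitaryConj_selfAdjointExt hp (hext θ hθ) (w := fun _ => 1) U hU, fun f x => ?_⟩
    simpa only [pointEval_apply, Complex.ofReal_one, one_pow, div_one] using
      hasSum_of_basis b (w := fun _ => 1) hb f x
  · obtain ⟨b, hb⟩ := hF.exists_pointEval_basis hp (hext θ hθ) hsqrt W hW
    refine ⟨fun n => ⟨hdens _, hdiag _⟩, ⟨b, hb⟩,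
      hF.unitaryConj_selfAdjointExt hp (hext θ hθ) W hW, fun f x => ?_⟩
    simpa only [pointEval_apply, hsq, hdiag] using hasSum_of_basis b hb f x
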